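/- Let $c>0$ and let $g$ be a continuous $1$-periodic function. Let $u$ be the continuous, spatially $1$-periodic viscosity solution of $\min(u_t+c\,u_x,\;u-g)=0$ $(t>0)$, $u(0,\cdot)=u_0$. For $\ell,p\in\mathbb N$ let $\mathcal C^{\ell+1}_{p,L,c_0}$ be the set of functions on $(0,1)$ that are Lipschitz with $\|v'\|_{L^\infty}\le L$ and, outside at most $p$ points, of class $C^{\ell+1}$ with $\|v^{(\ell+1)}\|_{L^\infty}\le c_0$. Assume that $u$ is not shattering on $[0,T]$, $T>0$: $u(t,\cdot)\in\mathcal C^{\ell+1}_{p,L,c_0}$ for every $t\in[0,T]$, with $\ell\ge 0,p,L,c_0$ independent of $t$. Let $I_1,\dots,I_N$ be a partition of $(0,1)$ into intervals of lengths $h_j$, $h=\max_j h_j$, let $k\ge 0$, let $V_h$ be the space of functions whose restriction to each $I_j$ is a polynomial of degree at most $k$ (extended periodically), let $\Pi_h$ be the $L^2(0,1)$-projection onto $V_h$, and let $x^j_\alpha$ ($0\le\alpha\le k$) be the $k+1$ Gauss–Legendre points of $I_j$, with weights $w_\alpha$, $\sum_\alpha w_\alpha=1$. Put $\|f\|=\|f\|_{L^2(0,1)}$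 and $\|f\|_{\ell^2}=\big(\sum_{j,\alpha}w_\alpha|f(x^j_\alpha)|^2h_j\big)^{1/2}$. Let $0<\Delta t\le T$, $t_n=n\Delta t$, $u^n=u(t_n,\cdot)$, $g_{\Delta t}(x)=\max_{\theta\in[0,\Delta t]}g(x-c\theta)$, and let $\tilde g$ be a real function (the numerical obstacle). The practical SLDG scheme is $u_h^0=\Pi_hu_0$ and: $u_h^{n+1}$ is the element of $V_h$ with $$u_h^{n+1}(x^j_\alpha)=\max\big(G_n(x^j_\alpha),\,\tilde g(x^j_\alpha)\big)\quad\text{for all }j,\alpha,\qquad G_n=\Pi_h\big(u_h^n(\cdot-c\Delta t)\big).$$ Let $q_{k,\ell}=\min(\min(k,\ell)+1,\tfrac32)$. Then for all $n$ with $t_n\le T$ $$\|u_h^n-u^n\|\le CT\,\frac{h^{q_{k,\ell}}}{\Delta t}+CT\,\frac{\|\tilde g-g_{\Delta t}\|_{\ell^2}}{\Delta t},$$ where $C\ge 0$ depends only on $k,\ell,p,L,c_0$. In particular: (i) if $\tilde g=g_{\Delta t}$, then $\|u_h^n-u^n\|\le CT\,h^{q_{k,\ell}}/\Delta t$ for all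 $t_n\le T$, with $C$ depending only on $k,\ell,p,L,c_0$; (ii) if $\tilde g(x)=\max(g(x),g(x-c\Delta t))$, and $g$ has at most $q$ local maximum points per period and is twice differentiable at each of them, then $\|u_h^n-u^n\|\le CT\,h^{q_{k,\ell}}/\Delta t+CT\,\Delta t\sqrt{\Delta t+h}$ for all $t_n\le T$, with $C$ depending only on $k,\ell,p,L,c_0,c,g,q$. Consequently, in case (ii) with $k,\ell\ge1$, if $\alpha h^{3/5}\le\Delta t\le\beta h^{3/5}$ for fixed $0<\alpha\le\beta$, then $\|u_h^n-u^n\|\le CT\,h^{9/10}$ for all $t_n\le T$, where $C$ depends only on the data listed in (ii) and on $\alpha,\beta$. -/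

import Mathlib

open Set Topology MeasureTheory Polynomial

noncomputable section

namespace SLDG

/-! All functions on the periodic unit interval are 1-periodic functions on the line. -/

/-! ### The continuous problem -/

/-- Continuous, spatially 1-periodic viscosity solutions of
`min (u_t + c u_x, u - g) = 0` for `t > 0`, with `u(0, x) = u₀(x)`.
The first argument of `u` is time, the second one is space. -/
structure IsViscositySolution (c : ℝ) (g u₀ : ℝ → ℝ) (u : ℝ → ℝ → ℝ) : Prop where
  continuousOn : ContinuousOn (fun z : ℝ × ℝ => u z.1 z.2) (Ici 0 ×ˢ univ)
  periodic : ∀ t, 0 ≤ t → Function.Periodic (u t) 1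
  initial : ∀ x, u 0 x = u₀ x
  subsolution : ∀ φ : ℝ × ℝ → ℝ, ContDiff ℝ 1 φ → ∀ t x : ℝ, 0 < t →
    IsLocalMax (fun z : ℝ × ℝ => u z.1 z.2 - φ z) (t, x) →
      min (fderiv ℝ φ (t, x) (1, 0) + c * fderiv ℝ φ (t, x) (0, 1)) (u t x - g x) ≤ 0
  supersolution : ∀ φ : ℝ × ℝ → ℝ, ContDiff ℝ 1 φ → ∀ t x : ℝ, 0 < t →
    IsLocalMin (fun z : ℝ × ℝ => u z.1 z.2 - φ z) (t, x) →
      0 ≤ min (fderiv ℝ φ (t, x) (1, 0) + c * fderiv ℝ φ (t, x) (0, 1)) (u t x - g x)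

/-- The class of functions on `(0,1)` that are Lipschitz with `‖v'‖_∞ ≤ L` and, off at most `p`
points, of class `C^(ℓ+1)` with `(ℓ+1)`-th derivative bounded by `c₀`. -/
def PiecewiseClass (ℓ p : ℕ) (L c₀ : ℝ) (v : ℝ → ℝ) : Prop :=
  (∀ x ∈ Ioo (0 : ℝ) 1, ∀ y ∈ Ioo (0 : ℝ) 1, |v x - v y| ≤ L * |x - y|) ∧
  ∃ S : Finset ℝ, S.card ≤ p ∧
    ContDiffOn ℝ ((ℓ + 1 : ℕ) : WithTop ℕ∞) v (Ioo (0 : ℝ) 1 \ (S : Set ℝ)) ∧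
    ∀ x ∈ Ioo (0 : ℝ) 1 \ (S : Set ℝ), |iteratedDeriv (ℓ + 1) v x| ≤ c₀

/-- The no-shattering property on `[0,T]`, with its constants made explicit. -/
def NotShattering (ℓ p : ℕ) (L c₀ T : ℝ) (u : ℝ → ℝ → ℝ) : Prop :=
  ∀ t ∈ Icc (0 : ℝ) T, PiecewiseClass ℓ p L c₀ (u t)

/-- Periodic functions with at most `q` local maximum points per period, twice differentiable at
each of them. -/
def DeltaTwo (q : ℕ) (g : ℝ → ℝ) : Prop :=
  {x ∈ Ico (0 : ℝ) 1 | IsLocalMax g x}.encard ≤ q ∧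
  ∀ x, IsLocalMax g x →
    (∀ᶠ y in 𝓝 x, DifferentiableAt ℝ g y) ∧ DifferentiableAt ℝ (deriv g) x

/-- `g_t(x) = max_{θ ∈ [0,t]} g(x - cθ)`. -/
def obstacleMax (c : ℝ) (g : ℝ → ℝ) (t x : ℝ) : ℝ :=
  sSup ((fun θ => g (x - c * θ)) '' Icc 0 t)

/-- The two-point obstacle `max (g(x), g(x - c Δt))`. -/
def obstacleTwoPoint (c : ℝ) (g : ℝ → ℝ) (dt x : ℝ) : ℝ :=
  max (g x) (g (x - c * dt))

/-! ### The mesh, the discontinuous Galerkin space and the projection -/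

/-- A partition of `(0,1)` into `N` open cells. -/
structure Mesh (N : ℕ) where
  pt : Fin (N + 1) → ℝ
  strictMono : StrictMono pt
  pt_zero : pt 0 = 0
  pt_last : pt (Fin.last N) = 1

/-- The `j`-th cell. -/
def Mesh.cell {N : ℕ} (m : Mesh N) (j : Fin N) : Set ℝ :=
  Ioo (m.pt j.castSucc) (m.pt j.succ)

/-- The length `h_j` of the `j`-th cell. -/
def Mesh.len {N : ℕ} (m : Mesh N) (j : Fin N) : ℝ :=
  m.pt j.succ - m.pt j.castSucc

/-- The mesh size `h = max_j h_j`. -/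
def Mesh.h {N : ℕ} (m : Mesh N) : ℝ :=
  ⨆ j, m.len j

/-- The space `V_h`: (periodically extended) functions which are polynomials of degree at most `k`
on each cell. The values at the mesh points are irrelevant. -/
def DGSpace {N : ℕ} (m : Mesh N) (k : ℕ) : Set (ℝ → ℝ) :=
  {v | Function.Periodic v 1 ∧
    ∀ j, ∃ P : ℝ[X], P.natDegree ≤ k ∧ ∀ x ∈ m.cell j, v x = P.eval x}

/-- `v = Π_h f`, the `L²(0,1)`-orthogonal projection of `f` onto `V_h`. -/
def IsL2Projection {N : ℕ} (m : Mesh N) (k : ℕ) (f v : ℝ → ℝ) : Prop :=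
  v ∈ DGSpace m k ∧
    ∀ φ ∈ DGSpace m k, ∫ x in Ioo (0 : ℝ) 1, (f x - v x) * φ x = 0

/-- The Gauss–Legendre rule with `k + 1` points on the reference interval `(0,1)`: the rule with
`k + 1` nodes that is exact for polynomials of degree at most `2k + 1`. -/
structure GaussLegendre (k : ℕ) where
  node : Fin (k + 1) → ℝ
  weight : Fin (k + 1) → ℝ
  strictMono : StrictMono node
  node_mem : ∀ a, node a ∈ Ioo (0 : ℝ) 1
  exact : ∀ P : ℝ[X], P.natDegree ≤ 2 * k + 1 →
    ∑ a, weight a * P.eval (node a) = ∫ x in Ioo (0 : ℝ) 1, P.eval x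

/-- The Gauss–Legendre point `x^j_a` of the cell `j`. -/
def gaussPoint {N k : ℕ} (m : Mesh N) (Q : GaussLegendre k) (j : Fin N) (a : Fin (k + 1)) : ℝ :=
  m.pt j.castSucc + m.len j * Q.node a

/-- The discrete pseudo-norm `‖f‖_{ℓ²} = (∑_{j,a} w_a |f(x^j_a)|² h_j)^{1/2}`. -/
def discreteNorm {N k : ℕ} (m : Mesh N) (Q : GaussLegendre k) (f : ℝ → ℝ) : ℝ :=
  √(∑ j, ∑ a, Q.weight a * |f (gaussPoint m Q j a)| ^ 2 * m.len j)

/-- The norm of `L²(0,1)`. -/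
def l2Norm (f : ℝ → ℝ) : ℝ :=
  √(∫ x in Ioo (0 : ℝ) 1, |f x| ^ 2)

/-! ### The scheme -/

/-- `uh n`, `n = 0, 1, …`, is produced by the semi-Lagrangian DG obstacle scheme with time step
`dt` and numerical obstacle `gt`: `uh 0 = Π_h u₀`, and `uh (n+1)` is the element of `V_h` that takes
the value `max (G (x), gt (x))` at each Gauss–Legendre point `x` of each cell, where
`G = Π_h (uh n (· - c dt))`. -/
structure IsSLDGObstacleScheme {N k : ℕ} (m : Mesh N) (Q : GaussLegendre k) (c dt : ℝ)
    (u₀ gt : ℝ → ℝ) (uh : ℕ → ℝ → ℝ) : Prop where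
  initial : IsL2Projection m k u₀ (uh 0)
  step : ∀ n, ∃ G : ℝ → ℝ, IsL2Projection m k (fun x => uh n (x - c * dt)) G ∧
    uh (n + 1) ∈ DGSpace m k ∧
    ∀ j a, uh (n + 1) (gaussPoint m Q j a) =
      max (G (gaussPoint m Q j a)) (gt (gaussPoint m Q j a))

/-- `q_{k,ℓ} = min (min (k, ℓ) + 1, 3/2)`. -/
def rateExp (k ℓ : ℕ) : ℝ :=
  min (min (k : ℝ) (ℓ : ℝ) + 1) (3 / 2)

end SLDG

end

/-!
The viscosity solution obeys a dynamic programming principle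
(`SLDG.IsViscositySolution.eq_max`): over one time step it is transported along the characteristics
`x - c t = const` and then obstructed by the running maximum of the obstacle. The scheme does the
same with a projection after the transport, and takes the maximum at the Gauss–Legendre points only.
The discrete norm at these points coincides with the `L²` norm on the discontinuous Galerkin space,
the projection and the maximum are nonexpansive, and so is the translation of periodic functions.
Hence the error grows by at most a constant number of approximation errors plus the discrete
distance of the obstacles in each step (`SLDG.exists_error_bound`); there are at most `T / dt` steps.

The dynamic programming principle is proved by testing with functions whose derivative in the
characteristic direction `(1, c)` is explicit: a strictly monotone exponential in time, plus a
penalty on `x - c t`, which is constant along characteristics. The supersolution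
property then shows that `u` is nondecreasing along characteristics, and the subsolution property
that it is nonincreasing where it exceeds the obstacle.

The approximation error of a Lipschitz function which is smooth off finitely many points is
`O(h ^ min (min (k, ℓ) + 1, 3/2))` (`SLDG.exists_DGSpace_approx`). If `k` or `ℓ` vanishes, piecewise
constants suffice. Otherwise the cells containing a singular point contribute `O(h ^ 3)` to the
squared error. On an interval of length `d` between singular points only the first and the
`(ℓ+1)`-th derivative are bounded; a Landau-type inequality gives a second derivative of size
`O(1 / d)`, so that the squared error of the affine approximation on a cell is
`O(h_j ^ 5 / d ^ 2) = O(h ^ 3 h_j / d)`, and the ratios `h_j / d` of the cells in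
one such interval add up to at most one.

The two-point obstacle differs from the running maximum only within distance `c dt` after a local
maximum point of `g`, and there by `O(dt ^ 2)`, because `g` falls off quadratically at such a
point. The affected cells have total length `O(dt + h)`, which gives the discrete distance
`O(dt ^ 2 √(dt + h))` (`SLDG.exists_discreteNorm_twoPoint_le`).
-/

namespace SLDG

/-! ### Viscosity solutions along characteristics -/

/-- Penalization: if `W` is smaller at `(t₂, 0)` than at `(t₁, 0)`, then `W` plus a function which
strictly increases in the first variable, and depends on the second one only through an additive
term, has a local minimum with first coordinate in `(t₁, t₃)` and small second coordinate. -/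
theorem exists_penalized_isLocalMin {W : ℝ × ℝ → ℝ} (hW : Continuous W) {t₁ t₂ t₃ r₀ : ℝ}
    (h₁₂ : t₁ < t₂) (h₂₃ : t₂ < t₃) (hr₀ : 0 < r₀) (hlt : W (t₂, 0) < W (t₁, 0)) :
    ∃ η K M : ℝ, 0 < η ∧ 0 < K ∧ ∃ z : ℝ × ℝ, z.1 ∈ Ioo t₁ t₃ ∧ z.2 ∈ Ioo (-r₀) r₀ ∧
      IsLocalMin (fun z : ℝ × ℝ => W z + (η * Real.exp (K * (z.1 - t₂)) + M * z.2 ^ 2)) z := by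
  set η := (W (t₁, 0) - W (t₂, 0)) / 2 with hη
  have hηpos : 0 < η := by rw [hη]; linarith
  have hnear : ∀ᶠ y in 𝓝 (0 : ℝ), W (t₂, 0) + η < W (t₁, y) := by
    have hc : ContinuousAt (fun y : ℝ => W (t₁, y)) 0 := by fun_prop
    exact hc.eventually (lt_mem_nhds (by rw [hη]; linarith))
  obtain ⟨r₁, hr₁, hball⟩ := Metric.eventually_nhds_iff.1 hnear
  set r := min r₀ (r₁ / 2) / 2 with hr
  have hmpos : 0 < min r₀ (r₁ / 2) := lt_min hr₀ (by linarith)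
  have hrpos : 0 < r := by rw [hr]; linarith
  have hrr₀ : r < r₀ := by
    have := min_le_left r₀ (r₁ / 2); rw [hr]; linarith
  have hrr₁ : r < r₁ := by
    have := min_le_right r₀ (r₁ / 2); rw [hr]; linarith
  have hcomp : IsCompact (Icc t₁ t₃ ×ˢ Icc (-r) r) := isCompact_Icc.prod isCompact_Icc
  obtain ⟨B, hB⟩ := hcomp.bddBelow_image hW.continuousOn
  have hB' : ∀ z ∈ Icc t₁ t₃ ×ˢ Icc (-r) r, B ≤ W z := fun z hz => hB ⟨z, hz, rfl⟩
  set D := |W (t₂, 0) + η - B| + 1 with hD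
  have hDpos : 0 < D := by positivity
  have hDgt : W (t₂, 0) + η < B + D := by
    have := le_abs_self (W (t₂, 0) + η - B); rw [hD]; linarith
  set K := D / (η * (t₃ - t₂)) with hK
  have h32 : 0 < t₃ - t₂ := by linarith
  have hKpos : 0 < K := by positivity
  set M := D / r ^ 2 with hM
  have hMpos : 0 < M := by positivity
  refine ⟨η, K, M, hηpos, hKpos, ?_⟩
  set F : ℝ × ℝ → ℝ := fun z => W z + (η * Real.exp (K * (z.1 - t₂)) + M * z.2 ^ 2) with hF
  have hFc : Continuous F := by rw [hF]; fun_prop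
  have hF2 : F (t₂, 0) = W (t₂, 0) + η := by simp [hF]
  have hbd : ∀ z' ∈ (Icc t₁ t₃ ×ˢ Icc (-r) r) \ (Ioo t₁ t₃ ×ˢ Ioo (-r) r), F (t₂, 0) < F z' := by
    rintro ⟨s, y⟩ ⟨hz, hz'⟩
    rw [hF2]
    have hBz := hB' _ hz
    have hexp := mul_pos hηpos (Real.exp_pos (K * (s - t₂)))
    have hsq : 0 ≤ M * y ^ 2 := by positivity
    obtain ⟨⟨hs1, hs2⟩, ⟨hy1, hy2⟩⟩ := hz
    simp only at hs1 hs2 hy1 hy2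
    simp only [hF]
    by_cases hy : y ∈ Ioo (-r) r
    · have hs : s ∉ Ioo t₁ t₃ := fun h => hz' ⟨h, hy⟩
      rcases eq_or_lt_of_le hs1 with rfl | hs1
      · have : W (t₂, 0) + η < W (t₁, y) :=
          hball (by rw [Real.dist_eq, sub_zero]; exact (abs_lt.2 hy).trans hrr₁)
        linarith
      · have hs3 : s = t₃ := le_antisymm hs2 (not_lt.1 fun h => hs ⟨hs1, h⟩)
        have h1 := Real.add_one_le_exp (K * (s - t₂))
        have h2 : η * (K * (s - t₂)) = D := by
          rw [hs3, hK]; field_simp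
        nlinarith
    · have hyr : r ≤ |y| := by
        by_contra! h
        exact hy (abs_lt.1 h)
      have h2 : M * r ^ 2 = D := by rw [hM]; field_simp
      have h3 : r ^ 2 ≤ y ^ 2 := by rw [← sq_abs y]; gcongr
      nlinarith
  obtain ⟨z, hz, hmin⟩ := hcomp.exists_isLocalMin_mem_open (s := Ioo t₁ t₃ ×ˢ Ioo (-r) r) (f := F)
    (z := (t₂, 0)) (prod_mono Ioo_subset_Icc_self Ioo_subset_Icc_self) hFc.continuousOn
    ⟨⟨h₁₂.le, h₂₃.le⟩, ⟨by simpa using hrpos.le, hrpos.le⟩⟩ hbd (isOpen_Ioo.prod isOpen_Ioo)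
  exact ⟨z, hz.1, ⟨by linarith [hz.2.1], by linarith [hz.2.2]⟩, hmin⟩

/-- The derivative in the direction `(1, c)`, along which `x - c t` is constant. -/
theorem fderiv_penalty (c a η K t₂ M t x : ℝ) :
    fderiv ℝ (fun z : ℝ × ℝ => η * Real.exp (K * (z.1 - t₂)) + M * (z.2 - a - c * z.1) ^ 2)
        (t, x) (1, 0) +
      c * fderiv ℝ (fun z : ℝ × ℝ => η * Real.exp (K * (z.1 - t₂)) +
        M * (z.2 - a - c * z.1) ^ 2) (t, x) (0, 1) =
      η * K * Real.exp (K * (t - t₂)) := by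
  set φ : ℝ × ℝ → ℝ := fun z => η * Real.exp (K * (z.1 - t₂)) + M * (z.2 - a - c * z.1) ^ 2
    with hφ
  have hd : DifferentiableAt ℝ φ (t, x) := by rw [hφ]; fun_prop
  have hv : ((1, c) : ℝ × ℝ) = (1, 0) + c • (0, 1) := by simp
  have h1 : fderiv ℝ φ (t, x) (1, 0) + c * fderiv ℝ φ (t, x) (0, 1) =
      fderiv ℝ φ (t, x) (1, c) := by
    rw [hv, map_add, map_smul, smul_eq_mul]
  have hcurve : HasDerivAt (fun s : ℝ => ((t + s, x + c * s) : ℝ × ℝ)) (1, c) 0 := by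
    refine HasDerivAt.prodMk ((hasDerivAt_id (0 : ℝ)).const_add t) ?_
    simpa using ((hasDerivAt_id (0 : ℝ)).const_mul c).const_add x
  have hd' : HasFDerivAt φ (fderiv ℝ φ (t, x)) ((fun s : ℝ => ((t + s, x + c * s) : ℝ × ℝ)) 0) := by
    simpa using hd.hasFDerivAt
  have h2 := hd'.comp_hasDerivAt (0 : ℝ) hcurve
  have h3 : HasDerivAt (φ ∘ fun s : ℝ => ((t + s, x + c * s) : ℝ × ℝ))
      (η * K * Real.exp (K * (t - t₂))) 0 := by
    have heq : (φ ∘ fun s : ℝ => ((t + s, x + c * s) : ℝ × ℝ)) =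
        fun s => η * Real.exp (K * (t + s - t₂)) + M * (x - a - c * t) ^ 2 := by
      funext s
      simp only [hφ, Function.comp]
      ring
    rw [heq]
    have h4 : HasDerivAt (fun s : ℝ => K * (t + s - t₂)) (K * 1) 0 :=
      (((hasDerivAt_id (0 : ℝ)).const_add t).sub_const t₂).const_mul K
    have h5 := ((h4.exp).const_mul η).add_const (M * (x - a - c * t) ^ 2)
    refine h5.congr_deriv ?_
    rw [add_zero]
    ring
  rw [h1]
  exact h2.unique h3

theorem contDiff_penalty (c a η K t₂ M : ℝ) : ContDiff ℝ 1
    (fun z : ℝ × ℝ => η * Real.exp (K * (z.1 - t₂)) + M * (z.2 - a - c * z.1) ^ 2) := by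
  fun_prop

namespace IsViscositySolution

variable {c : ℝ} {g u₀ : ℝ → ℝ} {u : ℝ → ℝ → ℝ}

theorem continuous_max (hu : IsViscositySolution c g u₀ u) :
    Continuous fun z : ℝ × ℝ => u (max z.1 0) z.2 := by
  have h : Continuous fun z : ℝ × ℝ => ((max z.1 0, z.2) : ℝ × ℝ) := by fun_prop
  exact hu.continuousOn.comp_continuous h fun z =>
    ⟨show (0 : ℝ) ≤ max z.1 0 from le_max_right _ _, mem_univ _⟩

theorem continuous_slice (hu : IsViscositySolution c g u₀ u) {t : ℝ} (ht : 0 ≤ t) :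
    Continuous (u t) := by
  have h := hu.continuous_max.comp (Continuous.prodMk_right t)
  simpa [Function.comp_def, max_eq_left ht] using h

/-- A local minimum in characteristic coordinates is a local minimum in `(t, x)`. -/
theorem isLocalMin_of_char {F : ℝ × ℝ → ℝ} {a : ℝ} {z : ℝ × ℝ} {ψ : ℝ × ℝ → ℝ} (hz : 0 < z.1)
    (h : IsLocalMin (fun z : ℝ × ℝ => F (max z.1 0, a + c * z.1 + z.2) + ψ z) z) :
    IsLocalMin (fun w : ℝ × ℝ => F w + ψ (w.1, w.2 - a - c * w.1))
      (z.1, a + c * z.1 + z.2) := by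
  set A : ℝ × ℝ → ℝ × ℝ := fun w => (w.1, w.2 - a - c * w.1) with hA
  have hAc : Continuous A := by rw [hA]; fun_prop
  have hAz : A (z.1, a + c * z.1 + z.2) = z := by
    ext
    · rfl
    · simp only [hA]; ring
  have ht : Filter.Tendsto A (𝓝 (z.1, a + c * z.1 + z.2)) (𝓝 z) := by
    have := hAc.tendsto (z.1, a + c * z.1 + z.2)
    rwa [hAz] at this
  have hpos : ∀ᶠ w : ℝ × ℝ in 𝓝 (z.1, a + c * z.1 + z.2), 0 < w.1 :=
    (continuous_fst.tendsto (z.1, a + c * z.1 + z.2)).eventually (lt_mem_nhds hz)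
  filter_upwards [ht.eventually h, hpos] with w hw hw0
  simp only [hA] at hw
  rw [max_eq_left hz.le, max_eq_left hw0.le] at hw
  have e1 : a + c * w.1 + (w.2 - a - c * w.1) = w.2 := by ring
  have e2 : a + c * z.1 + z.2 - a - c * z.1 = z.2 := by ring
  rw [e1] at hw
  simp only [e2]
  exact hw

/-- The supersolution property makes `u` nondecreasing along characteristics. -/
theorem monotone_char (hu : IsViscositySolution c g u₀ u) {t₁ t₂ a : ℝ} (h₁ : 0 ≤ t₁)
    (h₁₂ : t₁ ≤ t₂) : u t₁ (a + c * t₁) ≤ u t₂ (a + c * t₂) := by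
  rcases eq_or_lt_of_le h₁₂ with rfl | h₁₂
  · exact le_rfl
  by_contra! hlt
  set W : ℝ × ℝ → ℝ := fun z => u (max z.1 0) (a + c * z.1 + z.2) with hWdef
  have hW : Continuous W :=
    hu.continuous_max.comp (f := fun z : ℝ × ℝ => ((z.1, a + c * z.1 + z.2) : ℝ × ℝ))
      (by fun_prop)
  obtain ⟨η, K, M, hη, hK, z, hz1, -, hmin⟩ := exists_penalized_isLocalMin hW h₁₂
    (lt_add_one t₂) one_pos (by
      simpa [hWdef, max_eq_left h₁, max_eq_left (h₁.trans h₁₂.le)] using hlt)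
  have hz0 : 0 < z.1 := h₁.trans_lt hz1.1
  have hmin' := isLocalMin_of_char (c := c) (a := a) (F := fun w => u w.1 w.2)
    (ψ := fun z => η * Real.exp (K * (z.1 - t₂)) + M * z.2 ^ 2) hz0 hmin
  have hsup := hu.supersolution
    (fun w => -η * Real.exp (K * (w.1 - t₂)) + (-M) * (w.2 - a - c * w.1) ^ 2)
    (contDiff_penalty c a (-η) K t₂ (-M)) z.1 (a + c * z.1 + z.2) hz0 (by
      convert hmin' using 2
      ring)
  rw [fderiv_penalty] at hsup
  have h1 := hsup.trans (min_le_left _ _)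
  have h2 : 0 < η * K * Real.exp (K * (z.1 - t₂)) := by positivity
  linarith

/-- The subsolution property makes `u` nonincreasing along a piece of a characteristic on which
`u` stays strictly above the obstacle. -/
theorem antitone_char (hu : IsViscositySolution c g u₀ u) (hg : Continuous g) {t₁ t₂ a : ℝ}
    (h₁ : 0 ≤ t₁) (h₁₂ : t₁ ≤ t₂) (hgt : ∀ t ∈ Icc t₁ t₂, g (a + c * t) < u t (a + c * t)) :
    u t₂ (a + c * t₂) ≤ u t₁ (a + c * t₁) := by
  rcases eq_or_lt_of_le h₁₂ with rfl | h₁₂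
  · exact le_rfl
  by_contra! hlt
  set W : ℝ × ℝ → ℝ := fun z => u (max z.1 0) (a + c * z.1 + z.2) with hWdef
  have hW : Continuous W :=
    hu.continuous_max.comp (f := fun z : ℝ × ℝ => ((z.1, a + c * z.1 + z.2) : ℝ × ℝ))
      (by fun_prop)
  have hopen : IsOpen {z : ℝ × ℝ | g (a + c * z.1 + z.2) < W z} :=
    isOpen_lt (by fun_prop) hW
  -- By compactness `u` stays above the obstacle in a neighbourhood of the piece.
  obtain ⟨δ, hδ, hsub⟩ := ((isCompact_Icc (a := t₁) (b := t₂)).prod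
    (isCompact_singleton (x := (0 : ℝ)))).exists_cthickening_subset_open hopen (by
      rintro ⟨t, y⟩ ⟨ht, hy⟩
      simp only [mem_singleton_iff] at hy
      subst hy
      simpa [hWdef, max_eq_left (h₁.trans ht.1)] using hgt t ht)
  obtain ⟨η, K, M, hη, hK, z, hz1, hz2, hmin⟩ := exists_penalized_isLocalMin
    (W := fun z => - W z) hW.neg h₁₂ (lt_add_of_pos_right t₂ hδ) hδ (by
      simpa [hWdef, max_eq_left h₁, max_eq_left (h₁.trans h₁₂.le)] using hlt)
  have hz0 : 0 < z.1 := h₁.trans_lt hz1.1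
  have habove : g (a + c * z.1 + z.2) < W z := by
    refine hsub (Metric.mem_cthickening_of_dist_le z (min z.1 t₂, 0) δ _
      ⟨⟨le_min hz1.1.le h₁₂.le, min_le_right _ _⟩, rfl⟩ ?_)
    rw [Prod.dist_eq, Real.dist_eq, Real.dist_eq, sub_zero]
    refine max_le ?_ (abs_le.2 ⟨hz2.1.le, hz2.2.le⟩)
    rw [abs_of_nonneg (sub_nonneg.2 (min_le_left _ _))]
    rcases le_total z.1 t₂ with h | h
    · rw [min_eq_left h, sub_self]; exact hδ.le
    · rw [min_eq_right h]; linarith [hz1.2]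
  have hmin' := isLocalMin_of_char (c := c) (a := a) (F := fun w => - u w.1 w.2)
    (ψ := fun z => η * Real.exp (K * (z.1 - t₂)) + M * z.2 ^ 2) hz0 hmin
  have hsub := hu.subsolution
    (fun w => η * Real.exp (K * (w.1 - t₂)) + M * (w.2 - a - c * w.1) ^ 2)
    (contDiff_penalty c a η K t₂ M) z.1 (a + c * z.1 + z.2) hz0 (by
      refine hmin'.neg.congr (Filter.Eventually.of_forall fun w => ?_)
      ring)
  rw [fderiv_penalty] at hsub
  have h2 : 0 < η * K * Real.exp (K * (z.1 - t₂)) := by positivity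
  have h3 : 0 < u z.1 (a + c * z.1 + z.2) - g (a + c * z.1 + z.2) := by
    simp only [hWdef, max_eq_left hz0.le] at habove
    linarith
  exact absurd hsub (not_le.2 (lt_min h2 h3))

theorem obstacle_le_of_pos (hu : IsViscositySolution c g u₀ u) (hg : Continuous g) {t x : ℝ}
    (ht : 0 < t) : g x ≤ u t x := by
  by_contra! hlt
  set W : ℝ × ℝ → ℝ := fun z => u (max z.1 0) z.2 with hWdef
  have hW : Continuous W := hu.continuous_max
  have hopen : IsOpen {z : ℝ × ℝ | W z < g z.2 ∧ 0 < z.1} :=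
    (isOpen_lt hW (by fun_prop)).inter (isOpen_lt continuous_const continuous_fst)
  have hmem : ((t, x) : ℝ × ℝ) ∈ {z : ℝ × ℝ | W z < g z.2 ∧ 0 < z.1} :=
    ⟨by simpa [hWdef, max_eq_left ht.le] using hlt, ht⟩
  obtain ⟨r, hr, hball⟩ := Metric.nhds_basis_closedBall.mem_iff.1 (hopen.mem_nhds hmem)
  have hcomp := isCompact_closedBall ((t, x) : ℝ × ℝ) r
  obtain ⟨B, hB⟩ := hcomp.bddBelow_image hW.continuousOn
  have hB' : ∀ z ∈ Metric.closedBall ((t, x) : ℝ × ℝ) r, B ≤ W z := fun z hz => hB ⟨z, hz, rfl⟩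
  set D := |W (t, x) - B| + 1 with hD
  have hDpos : 0 < D := by positivity
  have hDgt : W (t, x) < B + D := by
    have := le_abs_self (W (t, x) - B); rw [hD]; linarith
  set M := D / r ^ 2 with hM
  have hMpos : 0 < M := by positivity
  have h2 : M * r ^ 2 = D := by rw [hM]; field_simp
  set F : ℝ × ℝ → ℝ := fun z => W z - -(M * ((z.1 - t) ^ 2 + (z.2 - x) ^ 2)) with hF
  have hFc : Continuous F := by rw [hF]; fun_prop
  obtain ⟨z, hz, hmin⟩ := hcomp.exists_isLocalMin_mem_open (s := Metric.ball (t, x) r) (f := F)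
    (z := (t, x)) Metric.ball_subset_closedBall hFc.continuousOn
    (Metric.mem_closedBall_self hr.le) (by
      rintro ⟨s, y⟩ ⟨hz, hz'⟩
      have hBz := hB' _ hz
      have hd : r ≤ max |s - t| |y - x| := by
        rwa [Metric.mem_ball, not_lt, Prod.dist_eq, Real.dist_eq, Real.dist_eq] at hz'
      have h3 : r ^ 2 ≤ (s - t) ^ 2 + (y - x) ^ 2 := by
        rcases le_max_iff.1 hd with h | h
        · have : r ^ 2 ≤ (s - t) ^ 2 := by rw [← sq_abs (s - t)]; gcongr
          nlinarith [sq_nonneg (y - x)]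
        · have : r ^ 2 ≤ (y - x) ^ 2 := by rw [← sq_abs (y - x)]; gcongr
          nlinarith [sq_nonneg (s - t)]
      simp only [hF, sub_self]
      nlinarith) Metric.isOpen_ball
  obtain ⟨hz1, hz2⟩ := hball (Metric.ball_subset_closedBall hz)
  have hmin' : IsLocalMin (fun w : ℝ × ℝ => u w.1 w.2 -
      (fun w : ℝ × ℝ => -(M * ((w.1 - t) ^ 2 + (w.2 - x) ^ 2))) w) (z.1, z.2) := by
    have hpos : ∀ᶠ w : ℝ × ℝ in 𝓝 z, 0 < w.1 :=
      (continuous_fst.tendsto z).eventually (lt_mem_nhds hz2)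
    filter_upwards [hmin, hpos] with w hw hw0
    simpa [hF, hWdef, max_eq_left hz2.le, max_eq_left hw0.le] using hw
  have h := (hu.supersolution _ (by fun_prop) z.1 z.2 hz2 hmin').trans (min_le_right _ _)
  simp only [hWdef, max_eq_left hz2.le] at hz1
  linarith

theorem obstacle_le (hu : IsViscositySolution c g u₀ u) (hg : Continuous g) {t x : ℝ}
    (ht : 0 ≤ t) : g x ≤ u t x := by
  have h1 : Continuous fun s : ℝ => u (max s 0) x :=
    hu.continuous_max.comp (f := fun s : ℝ => ((s, x) : ℝ × ℝ)) (by fun_prop)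
  have h2 : Filter.Tendsto (fun s : ℝ => u (max s 0) x) (𝓝[>] t) (𝓝 (u t x)) := by
    have := (h1.tendsto t).mono_left (nhdsWithin_le_nhds (s := Ioi t))
    rwa [max_eq_left ht] at this
  refine ge_of_tendsto h2 ?_
  filter_upwards [self_mem_nhdsWithin] with s hs
  have hs0 : 0 < s := ht.trans_lt hs
  rw [max_eq_left hs0.le]
  exact hu.obstacle_le_of_pos hg hs0

end IsViscositySolution

theorem bddAbove_obstacle {c : ℝ} {g : ℝ → ℝ} (hg : Continuous g) (t x : ℝ) :
    BddAbove ((fun θ => g (x - c * θ)) '' Icc 0 t) :=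
  isCompact_Icc.bddAbove_image (by fun_prop)

theorem le_obstacleMax {c : ℝ} {g : ℝ → ℝ} (hg : Continuous g) {t x θ : ℝ} (hθ : θ ∈ Icc 0 t) :
    g (x - c * θ) ≤ obstacleMax c g t x :=
  le_csSup (bddAbove_obstacle hg t x) ⟨θ, hθ, rfl⟩

/-- The dynamic programming principle: over a time `s` the solution is transported along the
characteristics and then obstructed by the running maximum of the obstacle. -/
theorem IsViscositySolution.eq_max {c : ℝ} {g u₀ : ℝ → ℝ} {u : ℝ → ℝ → ℝ}
    (hu : IsViscositySolution c g u₀ u) (hg : Continuous g) {t s : ℝ} (ht : 0 ≤ t) (hs : 0 ≤ s)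
    (x : ℝ) : u (t + s) x = max (u t (x - c * s)) (obstacleMax c g s x) := by
  set a := x - c * (t + s) with ha
  have hx : x = a + c * (t + s) := by rw [ha]; ring
  have hxs : x - c * s = a + c * t := by rw [ha]; ring
  apply le_antisymm
  · by_contra! hlt
    set B := max (u t (x - c * s)) (obstacleMax c g s x) with hB
    set φ : ℝ → ℝ := fun τ => u (max τ 0) (a + c * τ) with hφ
    have hφc : Continuous φ :=
      hu.continuous_max.comp (f := fun τ : ℝ => ((τ, a + c * τ) : ℝ × ℝ)) (by fun_prop)
    have hφe : ∀ τ, 0 ≤ τ → φ τ = u τ (a + c * τ) := fun τ hτ => by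
      simp only [hφ, max_eq_left hτ]
    -- The last time at which the solution is below the claimed bound.
    set S := {τ ∈ Icc t (t + s) | φ τ ≤ B} with hS
    have hSne : S.Nonempty := by
      refine ⟨t, ⟨le_rfl, by linarith⟩, ?_⟩
      rw [hφe t ht, ← hxs]
      exact le_max_left _ _
    have hScl : IsClosed S := isClosed_Icc.inter (isClosed_le hφc continuous_const)
    have hSb : BddAbove S := ⟨t + s, fun τ hτ => hτ.1.2⟩
    obtain ⟨hτ, hτB⟩ := hScl.csSup_mem hSne hSb
    set τ := sSup S with hτdef
    have hbig : ∀ σ, τ < σ → σ ≤ t + s → B < φ σ := by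
      intro σ h1 h2
      by_contra! h
      exact absurd (le_csSup hSb ⟨⟨hτ.1.trans h1.le, h2⟩, h⟩) (not_le.2 h1)
    have hend : φ (t + s) = u (t + s) x := by rw [hφe _ (by linarith), ← hx]
    have hτlt : τ < t + s := by
      refine lt_of_le_of_ne hτ.2 fun h => ?_
      rw [h, hend] at hτB
      exact absurd hτB (not_le.2 hlt)
    have hle : ∀ σ ∈ Ioo τ (t + s), u (t + s) x ≤ φ σ := by
      intro σ hσ
      have hσ0 : 0 ≤ σ := ht.trans (hτ.1.trans hσ.1.le)
      rw [hφe σ hσ0]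
      nth_rewrite 1 [hx]
      refine hu.antitone_char hg hσ0 hσ.2.le fun ρ hρ => ?_
      have hρ1 := hbig ρ (hσ.1.trans_le hρ.1) hρ.2
      rw [hφe ρ (hσ0.trans hρ.1)] at hρ1
      refine lt_of_le_of_lt ?_ hρ1
      refine le_trans ?_ (le_max_right _ _)
      have h := le_obstacleMax (c := c) hg (x := x) (t := s) (θ := t + s - ρ)
        ⟨by linarith [hρ.2], by linarith [hρ.1, hσ.1, hτ.1]⟩
      rwa [show x - c * (t + s - ρ) = a + c * ρ by rw [ha]; ring] at h
    have hlim : Filter.Tendsto φ (𝓝[>] τ) (𝓝 (φ τ)) :=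
      (hφc.tendsto τ).mono_left nhdsWithin_le_nhds
    have := ge_of_tendsto hlim (b := u (t + s) x) (by
      filter_upwards [Ioo_mem_nhdsGT hτlt] with σ hσ using hle σ hσ)
    linarith
  · refine max_le ?_ ?_
    · rw [hxs]
      conv_rhs => rw [hx]
      exact hu.monotone_char ht (by linarith)
    · refine csSup_le ((nonempty_Icc.2 hs).image _) ?_
      rintro _ ⟨θ, hθ, rfl⟩
      have h0 : 0 ≤ t + s - θ := by linarith [hθ.2]
      have e : x - c * θ = a + c * (t + s - θ) := by rw [ha]; ring
      refine (hu.obstacle_le hg h0 (x := x - c * θ)).trans ?_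
      rw [e]
      conv_rhs => rw [hx]
      exact hu.monotone_char h0 (by linarith [hθ.1])

/-! ### Geometry of the mesh -/

namespace Mesh

variable {N : ℕ} (m : Mesh N)

theorem len_pos (j : Fin N) : 0 < m.len j :=
  sub_pos.2 (m.strictMono j.castSucc_lt_succ)

theorem pt_mem (i : Fin (N + 1)) : m.pt i ∈ Icc (0 : ℝ) 1 :=
  ⟨m.pt_zero ▸ m.strictMono.monotone (Fin.zero_le i),
    m.pt_last ▸ m.strictMono.monotone (Fin.le_last i)⟩

theorem cell_subset (j : Fin N) : m.cell j ⊆ Ioo 0 1 :=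
  Ioo_subset_Ioo (m.pt_mem _).1 (m.pt_mem _).2

theorem measurableSet_cell (j : Fin N) : MeasurableSet (m.cell j) := measurableSet_Ioo

theorem pairwise_disjoint_cell : Pairwise (Function.onFun Disjoint m.cell) := by
  have key : ∀ i j : Fin N, i < j → Disjoint (m.cell i) (m.cell j) := by
    intro i j hij
    rw [Set.disjoint_left]
    intro x hx hy
    have : m.pt i.succ ≤ m.pt j.castSucc :=
      m.strictMono.monotone (Fin.succ_le_castSucc_iff.2 hij)
    exact absurd (hx.2.trans_le this) (not_lt.2 hy.1.le)
  intro i j hij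
  rcases lt_or_gt_of_ne hij with h | h
  · exact key i j h
  · exact (key j i h).symm

theorem exists_mem_cell {x : ℝ} (hx : x ∈ Ioo (0 : ℝ) 1) (hr : x ∉ range m.pt) :
    ∃ j, x ∈ m.cell j := by
  classical
  set s := Finset.univ.filter fun i : Fin (N + 1) => m.pt i ≤ x with hs
  have hne : s.Nonempty := ⟨0, by simp [hs, m.pt_zero, hx.1.le]⟩
  set i := s.max' hne with hi
  have hile : m.pt i ≤ x := (Finset.mem_filter.1 (s.max'_mem hne)).2
  have hlast : i ≠ Fin.last N := fun h => by
    rw [h, m.pt_last] at hile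
    exact absurd hile (not_le.2 hx.2)
  obtain ⟨j, hj⟩ := Fin.exists_castSucc_eq.2 hlast
  refine ⟨j, ?_, ?_⟩
  · rw [hj]
    exact lt_of_le_of_ne hile fun h => hr ⟨i, h⟩
  · by_contra! h
    have h1 : j.succ ≤ i := s.le_max' _ (by simp [hs, h])
    rw [← hj] at h1
    exact absurd h1 (not_le.2 j.castSucc_lt_succ)

theorem ae_eq_iUnion_cell : (Ioo (0 : ℝ) 1 : Set ℝ) =ᵐ[volume] ⋃ j, m.cell j := by
  have hnull : ∀ᵐ x : ℝ, x ∉ range m.pt :=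
    measure_eq_zero_iff_ae_notMem.1 ((finite_range m.pt).measure_zero volume)
  filter_upwards [hnull] with x hx
  apply propext
  constructor
  · intro h
    exact mem_iUnion.2 (m.exists_mem_cell h hx)
  · intro h
    obtain ⟨j, hj⟩ := mem_iUnion.1 h
    exact m.cell_subset j hj

theorem volume_cell (j : Fin N) : volume (m.cell j) = ENNReal.ofReal (m.len j) :=
  Real.volume_Ioo

/-- Cells contained in an interval have total length at most the length of the interval. -/
theorem sum_len_le (J : Finset (Fin N)) {a b : ℝ} (hab : a ≤ b)
    (hJ : ∀ j ∈ J, m.cell j ⊆ Icc a b) : ∑ j ∈ J, m.len j ≤ b - a := by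
  have h1 : volume (⋃ j ∈ J, m.cell j) = ∑ j ∈ J, volume (m.cell j) :=
    measure_biUnion_finset (fun i _ j _ hij => m.pairwise_disjoint_cell hij)
      fun j _ => m.measurableSet_cell j
  have h2 : volume (⋃ j ∈ J, m.cell j) ≤ volume (Icc a b) :=
    measure_mono (iUnion₂_subset hJ)
  rw [h1, Real.volume_Icc] at h2
  simp only [volume_cell] at h2
  rw [← ENNReal.ofReal_sum_of_nonneg fun j _ => (m.len_pos j).le] at h2
  exact (ENNReal.ofReal_le_ofReal_iff (sub_nonneg.2 hab)).1 h2

theorem sum_len_le_one : ∑ j, m.len j ≤ 1 := by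
  have := m.sum_len_le Finset.univ zero_le_one
    fun j _ => (m.cell_subset j).trans Ioo_subset_Icc_self
  simpa using this

theorem len_le_h (j : Fin N) : m.len j ≤ m.h :=
  le_ciSup (Set.finite_range m.len).bddAbove j

theorem len_le_one (j : Fin N) : m.len j ≤ 1 :=
  (Finset.single_le_sum (fun i _ => (m.len_pos i).le) (Finset.mem_univ j)).trans m.sum_len_le_one

theorem nonempty_index (m : Mesh N) : Nonempty (Fin N) := by
  rcases Nat.eq_zero_or_pos N with rfl | hN
  · have h0 := m.pt_zero
    have h1 := m.pt_last
    rw [show Fin.last 0 = 0 from rfl, h0] at h1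
    exact absurd h1 zero_ne_one
  · exact ⟨⟨0, hN⟩⟩

theorem h_pos : 0 < m.h := by
  obtain ⟨j⟩ := m.nonempty_index
  exact (m.len_pos j).trans_le (m.len_le_h j)

theorem h_le_one : m.h ≤ 1 := by
  have := m.nonempty_index
  exact ciSup_le m.len_le_one

end Mesh

/-! ### Norms, quadrature and projection -/

theorem l2Norm_eq_lpNorm {f : ℝ → ℝ} (hf : MemLp f 2 (volume.restrict (Ioo (0 : ℝ) 1))) :
    l2Norm f = lpNorm f 2 (volume.restrict (Ioo (0 : ℝ) 1)) := by
  rw [lpNorm_eq_integral_norm_rpow_toReal (by norm_num) (by norm_num) hf.1, l2Norm,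
    Real.sqrt_eq_rpow]
  simp

theorem l2Norm_add_le {f g : ℝ → ℝ} (hf : MemLp f 2 (volume.restrict (Ioo (0 : ℝ) 1)))
    (hg : MemLp g 2 (volume.restrict (Ioo (0 : ℝ) 1))) :
    l2Norm (fun x => f x + g x) ≤ l2Norm f + l2Norm g := by
  rw [l2Norm_eq_lpNorm hf, l2Norm_eq_lpNorm hg, ← Pi.add_def, l2Norm_eq_lpNorm (hf.add hg)]
  exact lpNorm_add_le hf (by norm_num)

theorem memLp_of_continuous {f : ℝ → ℝ} (hf : Continuous f) :
    MemLp f 2 (volume.restrict (Ioo (0 : ℝ) 1)) := by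
  rw [memLp_two_iff_integrable_sq hf.aestronglyMeasurable]
  exact ((hf.pow 2).integrableOn_Icc (a := 0) (b := 1)).mono_set Ioo_subset_Icc_self

theorem memLp_of_cells {N : ℕ} (m : Mesh N) {f : ℝ → ℝ}
    (hf : ∀ j, MemLp f 2 (volume.restrict (m.cell j))) :
    MemLp f 2 (volume.restrict (Ioo (0 : ℝ) 1)) := by
  rw [Measure.restrict_congr_set m.ae_eq_iUnion_cell]
  have hm : AEStronglyMeasurable f (volume.restrict (⋃ j, m.cell j)) :=
    aestronglyMeasurable_iUnion_iff.2 fun j => (hf j).1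
  rw [memLp_two_iff_integrable_sq hm]
  exact integrableOn_finite_iUnion.2 fun j => (hf j).integrable_sq

theorem memLp_of_mem_DGSpace {N : ℕ} {m : Mesh N} {k : ℕ} {v : ℝ → ℝ} (hv : v ∈ DGSpace m k) :
    MemLp v 2 (volume.restrict (Ioo (0 : ℝ) 1)) := by
  refine memLp_of_cells m fun j => ?_
  obtain ⟨P, -, hP⟩ := hv.2 j
  have hcont : Continuous fun x => P.eval x := P.continuous
  have h1 : MemLp (fun x => P.eval x) 2 (volume.restrict (m.cell j)) :=
    (memLp_of_continuous hcont).mono_measure (Measure.restrict_mono_set _ (m.cell_subset j))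
  refine h1.ae_eq ?_
  filter_upwards [ae_restrict_mem (m.measurableSet_cell j)] with x hx
  exact (hP x hx).symm

theorem sub_mem_DGSpace {N : ℕ} {m : Mesh N} {k : ℕ} {v w : ℝ → ℝ} (hv : v ∈ DGSpace m k)
    (hw : w ∈ DGSpace m k) : (fun x => v x - w x) ∈ DGSpace m k := by
  refine ⟨fun x => by simp only [hv.1 x, hw.1 x], fun j => ?_⟩
  obtain ⟨P, hP, hP'⟩ := hv.2 j
  obtain ⟨R, hR, hR'⟩ := hw.2 j
  refine ⟨P - R, (natDegree_sub_le_of_le hP hR).trans (by simp), fun x hx => ?_⟩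
  simp only [eval_sub, hP' x hx, hR' x hx]

theorem integral_eq_sum_cells {N : ℕ} (m : Mesh N) {f : ℝ → ℝ}
    (hf : IntegrableOn f (Ioo (0 : ℝ) 1)) :
    ∫ x in Ioo (0 : ℝ) 1, f x = ∑ j, ∫ x in m.cell j, f x := by
  rw [setIntegral_congr_set m.ae_eq_iUnion_cell]
  exact integral_iUnion_fintype m.measurableSet_cell m.pairwise_disjoint_cell
    fun j => hf.mono_set (m.cell_subset j)

namespace GaussLegendre

variable {k : ℕ} (Q : GaussLegendre k)

theorem weight_nonneg (a : Fin (k + 1)) : 0 ≤ Q.weight a := by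
  classical
  -- The square of the Lagrange polynomial of a node vanishes at the other nodes.
  set P : ℝ[X] := (∏ b ∈ Finset.univ.erase a, (X - C (Q.node b))) ^ 2 with hP
  have hdeg : P.natDegree ≤ 2 * k + 1 := by
    refine natDegree_pow_le.trans ?_
    have : (∏ b ∈ Finset.univ.erase a, (X - C (Q.node b))).natDegree = k := by
      rw [natDegree_prod_of_monic _ _ fun b _ => monic_X_sub_C _]
      simp
    omega
  have h := Q.exact P hdeg
  have hpos : 0 < P.eval (Q.node a) := by
    rw [hP, eval_pow, eval_prod]
    have : ∏ b ∈ Finset.univ.erase a, (X - C (Q.node b)).eval (Q.node a) ≠ 0 := by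
      refine Finset.prod_ne_zero_iff.2 fun b hb => ?_
      rw [eval_sub, eval_X, eval_C, sub_ne_zero]
      exact fun h => (Finset.ne_of_mem_erase hb) (Q.strictMono.injective h).symm
    positivity
  rw [Finset.sum_eq_single a] at h
  · have hint : 0 ≤ ∫ x in Ioo (0 : ℝ) 1, P.eval x :=
      integral_nonneg fun x => by rw [hP, eval_pow]; positivity
    rw [← h] at hint
    exact nonneg_of_mul_nonneg_left hint hpos
  · intro b _ hb
    rw [hP, eval_pow, eval_prod, Finset.prod_eq_zero (i := b)]
    · simp
    · exact Finset.mem_erase.2 ⟨hb, Finset.mem_univ b⟩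
    · simp
  · simp

theorem sum_weight : ∑ a, Q.weight a = 1 := by
  have h := Q.exact 1 (by simp)
  simpa using h

end GaussLegendre

section Quadrature

variable {N k : ℕ} {m : Mesh N} {Q : GaussLegendre k}

theorem gaussPoint_mem (m : Mesh N) (Q : GaussLegendre k) (j : Fin N) (a : Fin (k + 1)) :
    gaussPoint m Q j a ∈ m.cell j := by
  obtain ⟨h0, h1⟩ := Q.node_mem a
  have hl := m.len_pos j
  have hs : m.pt j.succ = m.pt j.castSucc + m.len j := by rw [Mesh.len]; ring
  rw [Mesh.cell, hs, gaussPoint]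
  constructor <;> nlinarith

/-- The Gauss–Legendre rule, transported to a cell. -/
theorem integral_cell_eq (m : Mesh N) (Q : GaussLegendre k) (j : Fin N) (P : ℝ[X])
    (hP : P.natDegree ≤ 2 * k + 1) :
    ∫ x in m.cell j, P.eval x = m.len j * ∑ a, Q.weight a * P.eval (gaussPoint m Q j a) := by
  set R : ℝ[X] := P.comp (C (m.pt j.castSucc) + C (m.len j) * X) with hR
  have hlin : (C (m.pt j.castSucc) + C (m.len j) * X).natDegree ≤ 1 := by
    rw [add_comm]; exact natDegree_linear_le
  have hdeg : R.natDegree ≤ 2 * k + 1 := by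
    rw [hR, natDegree_comp]
    exact (Nat.mul_le_mul hP hlin).trans (by omega)
  have heval : ∀ y, R.eval y = P.eval (m.pt j.castSucc + m.len j * y) := fun y => by
    simp [hR, eval_comp]
  have hex := Q.exact R hdeg
  simp only [heval] at hex
  have hs : m.pt j.succ = m.pt j.castSucc + m.len j * 1 := by rw [Mesh.len]; ring
  have hle : m.pt j.castSucc ≤ m.pt j.succ := m.strictMono.monotone j.castSucc_lt_succ.le
  have hsub := intervalIntegral.mul_integral_comp_add_mul (a := 0) (b := 1)
    (f := fun x => P.eval x) (m.len j) (m.pt j.castSucc)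
  rw [mul_zero, add_zero, ← hs, intervalIntegral.integral_of_le zero_le_one,
    intervalIntegral.integral_of_le hle, integral_Ioc_eq_integral_Ioo,
    integral_Ioc_eq_integral_Ioo] at hsub
  rw [Mesh.cell, ← hsub, ← hex]
  rfl

/-- On the discontinuous Galerkin space the discrete norm is the `L²` norm: the rule integrates
squares of polynomials of degree at most `k` exactly. -/
theorem discreteNorm_eq_l2Norm (Q : GaussLegendre k) {v : ℝ → ℝ} (hv : v ∈ DGSpace m k) :
    discreteNorm m Q v = l2Norm v := by
  have hint : IntegrableOn (fun x => |v x| ^ 2) (Ioo (0 : ℝ) 1) := by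
    simp only [sq_abs]
    exact (memLp_of_mem_DGSpace hv).integrable_sq
  rw [discreteNorm, l2Norm, integral_eq_sum_cells m hint]
  congr 1
  refine Finset.sum_congr rfl fun j _ => ?_
  obtain ⟨P, hP, hvP⟩ := hv.2 j
  have h1 : ∫ x in m.cell j, |v x| ^ 2 = ∫ x in m.cell j, (P ^ 2).eval x := by
    refine setIntegral_congr_fun (m.measurableSet_cell j) fun x hx => ?_
    simp [hvP x hx]
  have hdeg : (P ^ 2).natDegree ≤ 2 * k + 1 := natDegree_pow_le.trans (by omega)
  rw [h1, integral_cell_eq m Q j _ hdeg, Finset.mul_sum]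
  refine Finset.sum_congr rfl fun a _ => ?_
  rw [hvP _ (gaussPoint_mem m Q j a), eval_pow, sq_abs]
  ring

theorem discreteNorm_nonneg (f : ℝ → ℝ) : 0 ≤ discreteNorm m Q f := Real.sqrt_nonneg _

/-- Minkowski's inequality for weighted sums of squares. -/
theorem sqrt_sum_le_of_abs_le {ι : Type*} [Fintype ι] {w f g r : ι → ℝ} (hw : ∀ i, 0 ≤ w i)
    (h : ∀ i, |f i| ≤ |g i| + |r i|) :
    √(∑ i, w i * |f i| ^ 2) ≤ √(∑ i, w i * |g i| ^ 2) + √(∑ i, w i * |r i| ^ 2) := by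
  have hA : 0 ≤ ∑ i, w i * |g i| ^ 2 :=
    Finset.sum_nonneg fun i _ => mul_nonneg (hw i) (by positivity)
  have hB : 0 ≤ ∑ i, w i * |r i| ^ 2 :=
    Finset.sum_nonneg fun i _ => mul_nonneg (hw i) (by positivity)
  have hcs : ∑ i, w i * (|g i| * |r i|) ≤
      √(∑ i, w i * |g i| ^ 2) * √(∑ i, w i * |r i| ^ 2) := by
    have := Real.sum_mul_le_sqrt_mul_sqrt Finset.univ (fun i => √(w i) * |g i|)
      fun i => √(w i) * |r i|
    simp only [mul_pow, Real.sq_sqrt (hw _)] at this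
    refine le_of_eq_of_le (Finset.sum_congr rfl fun i _ => ?_) this
    nth_rewrite 1 [← Real.mul_self_sqrt (hw i)]
    ring
  refine Real.sqrt_le_iff.2 ⟨by positivity, ?_⟩
  rw [add_sq, Real.sq_sqrt hA, Real.sq_sqrt hB]
  calc ∑ i, w i * |f i| ^ 2 ≤ ∑ i, w i * (|g i| + |r i|) ^ 2 := by
        refine Finset.sum_le_sum fun i _ => mul_le_mul_of_nonneg_left ?_ (hw i)
        gcongr
        exact h i
    _ = ∑ i, w i * |g i| ^ 2 + 2 * ∑ i, w i * (|g i| * |r i|) + ∑ i, w i * |r i| ^ 2 := by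
        rw [Finset.mul_sum, ← Finset.sum_add_distrib, ← Finset.sum_add_distrib]
        exact Finset.sum_congr rfl fun i _ => by ring
    _ ≤ _ := by linarith

theorem discreteNorm_eq_sum_prod (m : Mesh N) (Q : GaussLegendre k) (f : ℝ → ℝ) :
    discreteNorm m Q f = √(∑ i : Fin N × Fin (k + 1),
      Q.weight i.2 * m.len i.1 * |f (gaussPoint m Q i.1 i.2)| ^ 2) := by
  rw [discreteNorm, Fintype.sum_prod_type]
  congr 1
  exact Finset.sum_congr rfl fun j _ => Finset.sum_congr rfl fun a _ => by ring

theorem discreteNorm_le_add {f g r : ℝ → ℝ}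
    (h : ∀ j a, |f (gaussPoint m Q j a)| ≤ |g (gaussPoint m Q j a)| + |r (gaussPoint m Q j a)|) :
    discreteNorm m Q f ≤ discreteNorm m Q g + discreteNorm m Q r := by
  simp only [discreteNorm_eq_sum_prod]
  exact sqrt_sum_le_of_abs_le
    (fun i => mul_nonneg (Q.weight_nonneg i.2) (m.len_pos i.1).le) fun i => h i.1 i.2

theorem discreteNorm_le_of_abs_le {f : ℝ → ℝ} {e : Fin N → ℝ}
    (h : ∀ j, ∀ x ∈ m.cell j, |f x| ≤ e j) :
    discreteNorm m Q f ≤ √(∑ j, m.len j * e j ^ 2) := by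
  refine Real.sqrt_le_sqrt (Finset.sum_le_sum fun j _ => ?_)
  calc ∑ a, Q.weight a * |f (gaussPoint m Q j a)| ^ 2 * m.len j
      ≤ ∑ a, Q.weight a * (m.len j * e j ^ 2) := by
        refine Finset.sum_le_sum fun a _ => ?_
        rw [mul_assoc, mul_comm (_ ^ 2)]
        have := Q.weight_nonneg a
        have := (m.len_pos j).le
        gcongr
        exact h j _ (gaussPoint_mem m Q j a)
    _ = m.len j * e j ^ 2 := by rw [← Finset.sum_mul, Q.sum_weight, one_mul]

theorem l2Norm_le_of_abs_le (m : Mesh N) {f : ℝ → ℝ} {e : Fin N → ℝ}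
    (hf : MemLp f 2 (volume.restrict (Ioo (0 : ℝ) 1)))
    (h : ∀ j, ∀ x ∈ m.cell j, |f x| ≤ e j) : l2Norm f ≤ √(∑ j, m.len j * e j ^ 2) := by
  have hint : IntegrableOn (fun x => |f x| ^ 2) (Ioo (0 : ℝ) 1) := by
    simp only [sq_abs]
    exact hf.integrable_sq
  refine Real.sqrt_le_sqrt ?_
  rw [integral_eq_sum_cells m hint]
  refine Finset.sum_le_sum fun j _ => ?_
  have hc : ∫ _x in m.cell j, e j ^ 2 = m.len j * e j ^ 2 := by
    rw [setIntegral_const, smul_eq_mul, measureReal_def, m.volume_cell,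
      ENNReal.toReal_ofReal (m.len_pos j).le]
  rw [← hc]
  refine setIntegral_mono_on (hint.mono_set (m.cell_subset j)) ?_ (m.measurableSet_cell j)
    fun x hx => ?_
  · exact integrableOn_const (by rw [m.volume_cell]; exact ENNReal.ofReal_ne_top)
  · have := h j x hx
    gcongr

/-- The `L²` projection is nonexpansive around every element of the space. -/
theorem IsL2Projection.l2Norm_sub_le {f v P : ℝ → ℝ} (hv : IsL2Projection m k f v)
    (hf : MemLp f 2 (volume.restrict (Ioo (0 : ℝ) 1))) (hP : P ∈ DGSpace m k) :
    l2Norm (fun x => v x - P x) ≤ l2Norm (fun x => f x - P x) := by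
  have hvL := memLp_of_mem_DGSpace hv.1
  have hPL := memLp_of_mem_DGSpace hP
  have h0 := hv.2 _ (sub_mem_DGSpace hv.1 hP)
  have i1 : Integrable (fun x => (f x - v x) ^ 2) (volume.restrict (Ioo (0 : ℝ) 1)) :=
    (hf.sub hvL).integrable_sq
  have i2 : Integrable (fun x => (v x - P x) ^ 2) (volume.restrict (Ioo (0 : ℝ) 1)) :=
    (hvL.sub hPL).integrable_sq
  have i3 : Integrable (fun x => (f x - v x) * (v x - P x))
      (volume.restrict (Ioo (0 : ℝ) 1)) := (hf.sub hvL).integrable_mul (hvL.sub hPL)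
  have hsplit : ∫ x in Ioo (0 : ℝ) 1, (f x - P x) ^ 2 =
      ∫ x in Ioo (0 : ℝ) 1, ((f x - v x) ^ 2 + (v x - P x) ^ 2) +
        2 * ((f x - v x) * (v x - P x)) := by
    congr 1
    funext x
    ring
  rw [integral_add (i1.fun_add i2) (i3.const_mul 2), integral_add i1 i2, integral_const_mul, h0,
    mul_zero, add_zero] at hsplit
  have hnn : 0 ≤ ∫ x in Ioo (0 : ℝ) 1, (f x - v x) ^ 2 := integral_nonneg fun x => by positivity
  rw [l2Norm, l2Norm]
  simp only [sq_abs]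
  exact Real.sqrt_le_sqrt (by linarith)

end Quadrature

theorem integral_Ioo_comp_sub_of_periodic {f : ℝ → ℝ} (hf : Function.Periodic f 1) (a : ℝ) :
    ∫ x in Ioo (0 : ℝ) 1, f (x - a) = ∫ x in Ioo (0 : ℝ) 1, f x := by
  rw [← integral_Ioc_eq_integral_Ioo, ← integral_Ioc_eq_integral_Ioo,
    ← intervalIntegral.integral_of_le zero_le_one, ← intervalIntegral.integral_of_le zero_le_one,
    intervalIntegral.integral_comp_sub_right]
  have := hf.intervalIntegral_add_eq (0 - a) 0
  rwa [zero_add, show 0 - a + 1 = 1 - a by ring] at this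

theorem l2Norm_comp_sub {f : ℝ → ℝ} (hf : Function.Periodic f 1) (a : ℝ) :
    l2Norm (fun x => f (x - a)) = l2Norm f := by
  rw [l2Norm, l2Norm]
  congr 1
  exact integral_Ioo_comp_sub_of_periodic (f := fun x => |f x| ^ 2) (fun x => by simp only [hf x]) a

theorem integrableOn_comp_sub_of_periodic {f : ℝ → ℝ} (hf : Function.Periodic f 1)
    (hi : IntegrableOn f (Ioo (0 : ℝ) 1)) (a : ℝ) :
    IntegrableOn (fun x => f (x - a)) (Ioo (0 : ℝ) 1) := by
  have h1 : IntervalIntegrable f volume 0 (0 + 1) := by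
    rw [zero_add, intervalIntegrable_iff_integrableOn_Ioo_of_le zero_le_one]
    exact hi
  have h2 := (hf.intervalIntegrable one_ne_zero h1 (0 - a) (1 - a)).comp_sub_right a
  rw [show 0 - a + a = 0 by ring, show 1 - a + a = 1 by ring,
    intervalIntegrable_iff_integrableOn_Ioo_of_le zero_le_one] at h2
  exact h2

theorem memLp_comp_sub_of_periodic {f : ℝ → ℝ} (hf : Function.Periodic f 1)
    (hi : MemLp f 2 (volume.restrict (Ioo (0 : ℝ) 1))) (a : ℝ) :
    MemLp (fun x => f (x - a)) 2 (volume.restrict (Ioo (0 : ℝ) 1)) := by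
  have h1 := integrableOn_comp_sub_of_periodic hf (hi.integrable (by norm_num)) a
  rw [memLp_two_iff_integrable_sq h1.1]
  exact integrableOn_comp_sub_of_periodic (f := fun x => f x ^ 2) (fun x => by simp only [hf x])
    hi.integrable_sq a

/-! ### An interpolation inequality for derivatives -/

/-- A function bounded by `A` on an interval of length `d`, with successive derivatives `F 1`,
`F 2`, …, has a point where the `j`-th derivative is at most of the order `A / d ^ j`. -/
theorem exists_point_deriv_le (j : ℕ) : ∃ C : ℝ, 0 ≤ C ∧ ∀ (F : ℕ → ℝ → ℝ) (a b A : ℝ), a < b →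
    (∀ i < j, ∀ x ∈ Ioo a b, HasDerivAt (F i) (F (i + 1) x) x) →
    (∀ x ∈ Ioo a b, |F 0 x| ≤ A) → ∃ x ∈ Ioo a b, |F j x| * (b - a) ^ j ≤ C * A := by
  induction j with
  | zero =>
    refine ⟨1, zero_le_one, fun F a b A hab _ hA => ⟨(a + b) / 2, ⟨by linarith, by linarith⟩, ?_⟩⟩
    simpa using hA _ ⟨by linarith, by linarith⟩
  | succ j ih =>
    obtain ⟨C, hC, ih⟩ := ih
    refine ⟨6 * 3 ^ j * C, by positivity, fun F a b A hab hF hA => ?_⟩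
    set d := b - a with hd
    have hdpos : 0 < d := sub_pos.2 hab
    -- A mean value argument between good points of the left third and of the right third.
    have hl : Ioo a (a + d / 3) ⊆ Ioo a b := Ioo_subset_Ioo_right (by linarith)
    have hr : Ioo (b - d / 3) b ⊆ Ioo a b := Ioo_subset_Ioo_left (by linarith)
    obtain ⟨x, hx, hxF⟩ := ih F a (a + d / 3) A (by linarith)
      (fun i hi y hy => hF i (by omega) y (hl hy)) fun y hy => hA y (hl hy)
    obtain ⟨y, hy, hyF⟩ := ih F (b - d / 3) b A (by linarith)
      (fun i hi y hy => hF i (by omega) y (hr hy)) fun y hy => hA y (hr hy)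
    rw [show a + d / 3 - a = d / 3 by ring] at hxF
    rw [show b - (b - d / 3) = d / 3 by ring] at hyF
    have hxy : d / 3 ≤ y - x := by linarith [hx.2, hy.1]
    have hxy' : x < y := by linarith
    have hsub : Icc x y ⊆ Ioo a b := fun z hz =>
      ⟨(hl hx).1.trans_le hz.1, hz.2.trans_lt (hr hy).2⟩
    obtain ⟨z, hz, hzF⟩ := exists_hasDerivAt_eq_slope (F j) (F (j + 1)) hxy'
      (fun z hz => (hF j (by omega) z (hsub hz)).continuousAt.continuousWithinAt)
      fun z hz => hF j (by omega) z (hsub (Ioo_subset_Icc_self hz))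
    refine ⟨z, hsub (Ioo_subset_Icc_self hz), ?_⟩
    have hmul : |F (j + 1) z| * (y - x) = |F j y - F j x| := by
      rw [hzF, abs_div, abs_of_pos (sub_pos.2 hxy'), div_mul_cancel₀ _ (sub_pos.2 hxy').ne']
    have habs : |F j y - F j x| ≤ |F j y| + |F j x| := abs_sub _ _
    have h1 : |F (j + 1) z| * (d / 3) ≤ |F j y| + |F j x| :=
      (mul_le_mul_of_nonneg_left hxy (abs_nonneg _)).trans (hmul.le.trans habs)
    have hpow : 0 ≤ (d / 3) ^ j := by positivity
    have h2 : |F (j + 1) z| * (d / 3) * (d / 3) ^ j ≤ 2 * (C * A) := by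
      nlinarith [mul_le_mul_of_nonneg_right h1 hpow]
    calc |F (j + 1) z| * d ^ (j + 1)
        = 3 * 3 ^ j * (|F (j + 1) z| * (d / 3) * (d / 3) ^ j) := by
          rw [div_pow]; field_simp; ring
      _ ≤ 3 * 3 ^ j * (2 * (C * A)) := by gcongr
      _ = 6 * 3 ^ j * C * A := by ring

/-- A Landau-type inequality: on an interval of length `d` the first derivative is controlled by
the function and its derivative of order `n + 1`. -/
theorem exists_landau_bound (n : ℕ) : ∃ C : ℝ, 0 ≤ C ∧ ∀ (F : ℕ → ℝ → ℝ) (a b A B : ℝ), a < b →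
    (∀ i < n + 1, ∀ x ∈ Ioo a b, HasDerivAt (F i) (F (i + 1) x) x) →
    (∀ x ∈ Ioo a b, |F 0 x| ≤ A) → (∀ x ∈ Ioo a b, |F (n + 1) x| ≤ B) →
    ∀ x ∈ Ioo a b, |F 1 x| * (b - a) ≤ C * (A + B * (b - a) ^ (n + 1)) := by
  induction n with
  | zero =>
    refine ⟨1, zero_le_one, fun F a b A B hab hF hA hB x hx => ?_⟩
    have h0 : 0 ≤ A := (abs_nonneg _).trans (hA x hx)
    have h1 := mul_le_mul_of_nonneg_right (hB x hx) (sub_pos.2 hab).le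
    simp only [zero_add] at h1 ⊢
    linarith
  | succ n ih =>
    obtain ⟨C, hC, ih⟩ := ih
    obtain ⟨C', hC', hpt⟩ := exists_point_deriv_le (n + 1)
    refine ⟨C * (1 + C'), by positivity, fun F a b A B hab hF hA hB x hx => ?_⟩
    set d := b - a with hd
    have hdpos : 0 < d := sub_pos.2 hab
    have hA0 : 0 ≤ A := (abs_nonneg _).trans (hA x hx)
    have hB0 : 0 ≤ B := (abs_nonneg _).trans (hB x hx)
    obtain ⟨y, hy, hyF⟩ := hpt F a b A hab (fun i hi => hF i (by omega)) hA
    have hbound : ∀ z ∈ Ioo a b, |F (n + 1) z| ≤ C' * A / d ^ (n + 1) + B * d := by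
      intro z hz
      have hmvt := (convex_Ioo a b).norm_image_sub_le_of_norm_hasDerivWithin_le (f := F (n + 1))
        (f' := F (n + 1 + 1)) (C := B)
        (fun w hw => (hF (n + 1) (by omega) w hw).hasDerivWithinAt)
        (fun w hw => hB w hw) hy hz
      rw [Real.norm_eq_abs, Real.norm_eq_abs] at hmvt
      have hzy : |z - y| ≤ d := by
        rw [abs_le]; constructor <;> linarith [hy.1, hy.2, hz.1, hz.2]
      have h1 : |F (n + 1) y| ≤ C' * A / d ^ (n + 1) := by
        rw [le_div_iff₀ (by positivity)]
        exact hyF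
      have h2 : |F (n + 1) z| ≤ |F (n + 1) y| + |F (n + 1) z - F (n + 1) y| := by
        have := abs_add_le (F (n + 1) y) (F (n + 1) z - F (n + 1) y)
        rwa [add_sub_cancel] at this
      have h3 := mul_le_mul_of_nonneg_left hzy hB0
      linarith
    refine (ih F a b A _ hab (fun i hi => hF i (by omega)) hA hbound x hx).trans ?_
    have e1 : (C' * A / d ^ (n + 1) + B * d) * d ^ (n + 1) = C' * A + B * d ^ (n + 1 + 1) := by
      field_simp
      ring
    rw [← hd, e1]
    have h4 : 0 ≤ C * (C' * (B * d ^ (n + 1 + 1))) := by positivity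
    nlinarith

/-! ### Approximation by piecewise polynomials -/

/-- Functions on the line which are `Λ`-Lipschitz at distances up to `1` and which, on `(0,1)` and
off the finite set `S`, are of class `C^(ℓ+1)` with `(ℓ+1)`-th derivative bounded by `c₀`. Unlike
the class on `(0,1)` used for the solution, it is stable under translations of periodic functions,
up to enlarging `S`. -/
def SmoothOff (ℓ : ℕ) (Λ c₀ : ℝ) (S : Finset ℝ) (w : ℝ → ℝ) : Prop :=
  (∀ x y, |x - y| ≤ 1 → |w x - w y| ≤ Λ * |x - y|) ∧
  ∀ x ∈ Ioo (0 : ℝ) 1, x ∉ S →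
    ContDiffAt ℝ ((ℓ + 1 : ℕ) : WithTop ℕ∞) w x ∧ |iteratedDeriv (ℓ + 1) w x| ≤ c₀

theorem hasDerivAt_iteratedDeriv {n i : ℕ} {f : ℝ → ℝ} {x : ℝ}
    (h : ContDiffAt ℝ (n : WithTop ℕ∞) f x) (hi : i < n) :
    HasDerivAt (iteratedDeriv i f) (iteratedDeriv (i + 1) f x) x := by
  rw [iteratedDeriv_succ]
  have h1 : DifferentiableAt ℝ (iteratedFDeriv ℝ i f) x :=
    h.differentiableAt_iteratedFDeriv (by exact_mod_cast hi)
  have h2 : DifferentiableAt ℝ (iteratedDeriv i f) x := by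
    rw [iteratedDeriv_eq_equiv_comp]
    exact (LinearIsometryEquiv.comp_differentiableAt_iff _).2 h1
  exact h2.hasDerivAt

/-- On an interval of length `d` free of singular points the second derivative is `O(1 / d)`. -/
theorem exists_second_deriv_bound {ℓ : ℕ} (hℓ : 1 ≤ ℓ) {Λ c₀ : ℝ} (hΛ : 0 ≤ Λ) (hc₀ : 0 ≤ c₀) :
    ∃ C : ℝ, 0 ≤ C ∧ ∀ (S : Finset ℝ) (w : ℝ → ℝ), SmoothOff ℓ Λ c₀ S w → ∀ a b : ℝ, a < b →
      0 ≤ a → b ≤ 1 → (∀ x ∈ Ioo a b, x ∉ S) → ∀ x ∈ Ioo a b,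
        HasDerivAt w (deriv w x) x ∧ HasDerivAt (deriv w) (iteratedDeriv 2 w x) x ∧
          |iteratedDeriv 2 w x| ≤ C / (b - a) := by
  obtain ⟨n, rfl⟩ : ∃ n, ℓ = n + 1 := ⟨ℓ - 1, by omega⟩
  obtain ⟨C, hC, hland⟩ := exists_landau_bound n
  refine ⟨C * (Λ + c₀), by positivity, fun S w hw a b hab ha hb hS x hx => ?_⟩
  have hmem : ∀ y ∈ Ioo a b, y ∈ Ioo (0 : ℝ) 1 := fun y hy => ⟨ha.trans_lt hy.1, hy.2.trans_le hb⟩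
  have hder : ∀ y ∈ Ioo a b, ∀ i < n + 1 + 1,
      HasDerivAt (iteratedDeriv i w) (iteratedDeriv (i + 1) w y) y := fun y hy i hi =>
    hasDerivAt_iteratedDeriv (hw.2 y (hmem y hy) (hS y hy)).1 hi
  have h0 := hder x hx 0 (by omega)
  have h1 := hder x hx 1 (by omega)
  simp only [zero_add, iteratedDeriv_zero, iteratedDeriv_one] at h0 h1
  refine ⟨h0, h1, ?_⟩
  have h2 := hland (fun i => iteratedDeriv (i + 1) w) a b Λ c₀ hab
    (fun i hi y hy => hder y hy (i + 1) (by omega)) (fun y _ => by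
      simp only [zero_add, iteratedDeriv_one, ← Real.norm_eq_abs]
      refine norm_deriv_le_of_lip' (f := w) hΛ ?_
      filter_upwards [Metric.ball_mem_nhds y one_pos] with z hz
      rw [Metric.mem_ball, Real.dist_eq] at hz
      exact hw.1 z y hz.le) (fun y hy => (hw.2 y (hmem y hy) (hS y hy)).2) x hx
  rw [le_div_iff₀ (sub_pos.2 hab)]
  refine h2.trans ?_
  have h3 : (b - a) ^ (n + 1) ≤ 1 := pow_le_one₀ (by linarith) (by linarith)
  have h4 : c₀ * (b - a) ^ (n + 1) ≤ c₀ := mul_le_of_le_one_right hc₀ h3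
  gcongr

theorem abs_sub_linear_le {w : ℝ → ℝ} {a b M y : ℝ} (hy : y ∈ Ioo a b)
    (h1 : ∀ x ∈ Ioo a b, HasDerivAt w (deriv w x) x)
    (h2 : ∀ x ∈ Ioo a b, HasDerivAt (deriv w) (iteratedDeriv 2 w x) x)
    (hM : ∀ x ∈ Ioo a b, |iteratedDeriv 2 w x| ≤ M) {x : ℝ} (hx : x ∈ Ioo a b) :
    |w x - (w y + deriv w y * (x - y))| ≤ M * (b - a) ^ 2 := by
  have hM0 : 0 ≤ M := (abs_nonneg _).trans (hM x hx)
  have hdist : ∀ z ∈ Ioo a b, |z - y| ≤ b - a := fun z hz => by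
    rw [abs_le]; constructor <;> linarith [hy.1, hy.2, hz.1, hz.2]
  have hd : ∀ z ∈ Ioo a b, |deriv w z - deriv w y| ≤ M * (b - a) := fun z hz => by
    refine ((convex_Ioo a b).norm_image_sub_le_of_norm_hasDerivWithin_le
      (fun w hw => (h2 w hw).hasDerivWithinAt) (fun w hw => hM w hw) hy hz).trans ?_
    exact mul_le_mul_of_nonneg_left (hdist z hz) hM0
  have h3 := (convex_Ioo a b).norm_image_sub_le_of_norm_hasDerivWithin_le
    (f := fun z => w z - deriv w y * z) (f' := fun z => deriv w z - deriv w y)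
    (C := M * (b - a)) (fun z hz => by
      have := (h1 z hz).sub ((hasDerivAt_id z).const_mul (deriv w y))
      rw [mul_one] at this
      exact this.hasDerivWithinAt) (fun z hz => hd z hz) hy hx
  rw [Real.norm_eq_abs, Real.norm_eq_abs] at h3
  have hba : 0 ≤ b - a := by linarith [hy.1, hy.2]
  calc |w x - (w y + deriv w y * (x - y))|
      = |w x - deriv w y * x - (w y - deriv w y * y)| := by congr 1; ring
    _ ≤ M * (b - a) * |x - y| := h3
    _ ≤ M * (b - a) * (b - a) := by
        have := hdist x hx
        gcongr
    _ = M * (b - a) ^ 2 := by ring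

/-- An interval without singular points lies in a maximal one, with end points in
`S ∪ {0}` and `S ∪ {1}`. -/
theorem exists_component (S : Finset ℝ) {α β : ℝ} (hα : 0 ≤ α) (hβ : β ≤ 1)
    (hS : ∀ x ∈ Ioo α β, x ∉ S) : ∃ a ∈ insert 0 S, ∃ b ∈ insert 1 S, 0 ≤ a ∧ a ≤ α ∧ β ≤ b ∧
      b ≤ 1 ∧ ∀ x ∈ Ioo a b, x ∉ S := by
  classical
  set A := (insert 0 S).filter fun x => 0 ≤ x ∧ x ≤ α with hA
  set B := (insert 1 S).filter fun x => β ≤ x ∧ x ≤ 1 with hB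
  have hAne : A.Nonempty := ⟨0, by simp [hA, hα]⟩
  have hBne : B.Nonempty := ⟨1, by simp [hB, hβ]⟩
  obtain ⟨ha1, ha2, ha3⟩ := Finset.mem_filter.1 (A.max'_mem hAne)
  obtain ⟨hb1, hb2, hb3⟩ := Finset.mem_filter.1 (B.min'_mem hBne)
  refine ⟨A.max' hAne, ha1, B.min' hBne, hb1, ha2, ha3, hb2, hb3, fun x hx hxS => ?_⟩
  rcases le_or_gt x α with h | h
  · have := A.le_max' x (Finset.mem_filter.2
      ⟨Finset.mem_insert_of_mem hxS, ha2.trans hx.1.le, h⟩)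
    exact absurd this (not_le.2 hx.1)
  rcases le_or_gt β x with h' | h'
  · have := B.min'_le x (Finset.mem_filter.2
      ⟨Finset.mem_insert_of_mem hxS, h', hx.2.le.trans hb3⟩)
    exact absurd this (not_le.2 hx.2)
  · exact hS x ⟨h, h'⟩ hxS

theorem exists_mem_DGSpace {N : ℕ} (m : Mesh N) (k : ℕ) (R : Fin N → ℝ[X])
    (hR : ∀ j, (R j).natDegree ≤ k) :
    ∃ P ∈ DGSpace m k, ∀ j, ∀ x ∈ m.cell j, P x = (R j).eval x := by
  classical
  have key : ∀ j, ∀ x ∈ m.cell j,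
      ∑ i, (m.cell i).indicator (fun y => (R i).eval y) (Int.fract x) = (R j).eval x := by
    intro j x hx
    have hx' := m.cell_subset j hx
    rw [Int.fract_eq_self.2 ⟨hx'.1.le, hx'.2⟩, Finset.sum_eq_single j]
    · rw [indicator_of_mem hx]
    · intro i _ hij
      exact indicator_of_notMem (fun h => (m.pairwise_disjoint_cell hij).le_bot ⟨h, hx⟩) _
    · simp
  refine ⟨fun x => ∑ i, (m.cell i).indicator (fun y => (R i).eval y) (Int.fract x),
    ⟨fun x => ?_, fun j => ⟨R j, hR j, key j⟩⟩, key⟩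
  simp only [Int.fract_add_one]

theorem abs_sub_const_le {ℓ : ℕ} {Λ c₀ : ℝ} (hΛ : 0 ≤ Λ) {S : Finset ℝ} {w : ℝ → ℝ}
    (hw : SmoothOff ℓ Λ c₀ S w) {N : ℕ} (m : Mesh N) (j : Fin N) :
    ∀ x ∈ m.cell j, |w x - (C (w (m.pt j.castSucc))).eval x| ≤ Λ * m.len j := by
  intro x hx
  have h1 : |x - m.pt j.castSucc| ≤ m.len j := by
    rw [abs_of_pos (sub_pos.2 hx.1), Mesh.len]
    linarith [hx.2]
  rw [eval_C]
  exact (hw.1 _ _ (h1.trans (m.len_le_one j))).trans (mul_le_mul_of_nonneg_left h1 hΛ)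

/-- Cellwise approximation by affine functions. A cell either contains a singular point, and then
the error is `O(h_j)`, or lies in an interval of length `d` between two singular points, and
then the error is `O(h_j ^ 2 / d)`. -/
theorem exists_cell_approx {k ℓ : ℕ} (hk : 1 ≤ k) (hℓ : 1 ≤ ℓ) {Λ c₀ : ℝ} (hΛ : 0 ≤ Λ)
    (hc₀ : 0 ≤ c₀) : ∃ K : ℝ, 0 ≤ K ∧ ∀ (S : Finset ℝ) (w : ℝ → ℝ), SmoothOff ℓ Λ c₀ S w →
      ∀ (N : ℕ) (m : Mesh N) (j : Fin N), ∃ (R : ℝ[X]) (e : ℝ) (t : ℝ × ℝ), R.natDegree ≤ k ∧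
        (∀ x ∈ m.cell j, |w x - R.eval x| ≤ e) ∧
        ((t.1 ∈ S ∧ t.1 ∈ m.cell j ∧ e = Λ * m.len j) ∨
          (t ∈ insert 0 S ×ˢ insert 1 S ∧ m.cell j ⊆ Icc t.1 t.2 ∧ m.len j ≤ t.2 - t.1 ∧
            e = K / (t.2 - t.1) * m.len j ^ 2)) := by
  obtain ⟨K, hK, hbd⟩ := exists_second_deriv_bound hℓ hΛ hc₀
  refine ⟨K, hK, fun S w hw N m j => ?_⟩
  by_cases hS : ∃ s ∈ S, s ∈ m.cell j
  · obtain ⟨s, hs, hsj⟩ := hS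
    exact ⟨C (w (m.pt j.castSucc)), Λ * m.len j, (s, s), by simp, abs_sub_const_le hΛ hw m j,
      Or.inl ⟨hs, hsj, rfl⟩⟩
  · push Not at hS
    obtain ⟨a, ha, b, hb, ha0, haα, hβb, hb1, hab⟩ := exists_component S
      (m.pt_mem j.castSucc).1 (m.pt_mem j.succ).2
      fun x hx hxS => hS x hxS hx
    have hsub : m.cell j ⊆ Ioo a b := Ioo_subset_Ioo haα hβb
    have hlt : a < b := haα.trans_lt ((m.strictMono j.castSucc_lt_succ).trans_le hβb)
    have h := hbd S w hw a b hlt ha0 hb1 hab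
    set y := (m.pt j.castSucc + m.pt j.succ) / 2 with hy
    have hyc : y ∈ m.cell j := by
      have := m.strictMono j.castSucc_lt_succ
      constructor <;> rw [hy] <;> linarith
    refine ⟨C (w y) + C (deriv w y) * (X - C y), K / (b - a) * m.len j ^ 2, (a, b), ?_, ?_,
      Or.inr ⟨Finset.mem_product.2 ⟨ha, hb⟩, hsub.trans Ioo_subset_Icc_self, ?_, rfl⟩⟩
    · refine (natDegree_add_le _ _).trans (max_le (by simp) ?_)
      exact (natDegree_C_mul_le _ _).trans ((natDegree_X_sub_C y).le.trans hk)
    · intro x hx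
      simp only [eval_add, eval_C, eval_mul, eval_sub, eval_X]
      exact abs_sub_linear_le hyc (fun z hz => (h z (hsub hz)).1)
        (fun z hz => (h z (hsub hz)).2.1) (fun z hz => (h z (hsub hz)).2.2) hx
    · rw [Mesh.len]
      linarith

theorem rateExp_eq_of_one_le {k ℓ : ℕ} (hk : 1 ≤ k) (hℓ : 1 ≤ ℓ) : rateExp k ℓ = 3 / 2 := by
  have h1 : (1 : ℝ) ≤ min (k : ℝ) ℓ :=
    le_min (by exact_mod_cast hk) (by exact_mod_cast hℓ)
  rw [rateExp, min_eq_right]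
  linarith

/-- Piecewise polynomials of degree at most `k` approximate functions which are smooth off `p`
points at the rate `rateExp k ℓ` in mean square, with pointwise error bounds on the cells. -/
theorem exists_DGSpace_approx (k ℓ p : ℕ) {Λ c₀ : ℝ} (hΛ : 0 ≤ Λ) (hc₀ : 0 ≤ c₀) :
    ∃ K : ℝ, 0 ≤ K ∧ ∀ (S : Finset ℝ) (w : ℝ → ℝ), S.card ≤ p → SmoothOff ℓ Λ c₀ S w →
      ∀ (N : ℕ) (m : Mesh N), ∃ P ∈ DGSpace m k, ∃ e : Fin N → ℝ,
        (∀ j, ∀ x ∈ m.cell j, |w x - P x| ≤ e j) ∧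
        √(∑ j, m.len j * e j ^ 2) ≤ K * m.h ^ rateExp k ℓ := by
  classical
  by_cases hkl : 1 ≤ k ∧ 1 ≤ ℓ
  · obtain ⟨K, hK, hcell⟩ := exists_cell_approx hkl.1 hkl.2 hΛ hc₀
    have hrate := rateExp_eq_of_one_le hkl.1 hkl.2
    refine ⟨√(p * Λ ^ 2 + (p + 1) ^ 2 * K ^ 2), Real.sqrt_nonneg _, fun S w hcard hw N m => ?_⟩
    choose R e t hdeg hR ht using hcell S w hw N m
    obtain ⟨P, hP, hPR⟩ := exists_mem_DGSpace m k R hdeg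
    refine ⟨P, hP, e, fun j x hx => by rw [hPR j x hx]; exact hR j x hx, ?_⟩
    have hh := m.h_pos
    have hpow : m.h ^ rateExp k ℓ = √(m.h ^ 3) := by
      rw [hrate, Real.sqrt_eq_rpow, ← Real.rpow_natCast, ← Real.rpow_mul hh.le]
      norm_num
    rw [hpow, ← Real.sqrt_mul (by positivity), add_mul]
    refine Real.sqrt_le_sqrt ?_
    set bad : Fin N → Prop := fun j => (t j).1 ∈ S ∧ (t j).1 ∈ m.cell j ∧ e j = Λ * m.len j
      with hbad
    rw [← Finset.sum_filter_add_sum_filter_not _ bad]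
    refine add_le_add ?_ ?_
    · -- Each singular point lies in at most one cell.
      have hc : (Finset.univ.filter bad).card ≤ p := by
        refine le_trans (Finset.card_le_card_of_injOn (fun j => (t j).1)
          (fun j hj => (Finset.mem_filter.1 hj).2.1) fun i hi j hj hij => ?_) hcard
        by_contra hne
        have h1 := (Finset.mem_filter.1 hi).2.2.1
        have h2 := (Finset.mem_filter.1 hj).2.2.1
        simp only at hij
        rw [hij] at h1
        exact (m.pairwise_disjoint_cell hne).le_bot ⟨h1, h2⟩
      calc ∑ j ∈ Finset.univ.filter bad, m.len j * e j ^ 2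
          ≤ ∑ _j ∈ Finset.univ.filter bad, Λ ^ 2 * m.h ^ 3 := by
            refine Finset.sum_le_sum fun j hj => ?_
            rw [(Finset.mem_filter.1 hj).2.2.2]
            have h1 := m.len_le_h j
            have h2 := (m.len_pos j).le
            calc m.len j * (Λ * m.len j) ^ 2 = Λ ^ 2 * m.len j ^ 3 := by ring
              _ ≤ _ := by gcongr
        _ = (Finset.univ.filter bad).card * (Λ ^ 2 * m.h ^ 3) := by
            rw [Finset.sum_const, nsmul_eq_mul]
        _ ≤ p * (Λ ^ 2 * m.h ^ 3) := by gcongr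
        _ = _ := by ring
    · -- The cells between two given singular points have total relative length at most one.
      set J := Finset.univ.filter fun j => ¬ bad j with hJ
      have hgood : ∀ j ∈ J, t j ∈ insert 0 S ×ˢ insert 1 S ∧
          m.cell j ⊆ Icc (t j).1 (t j).2 ∧ m.len j ≤ (t j).2 - (t j).1 ∧
            e j = K / ((t j).2 - (t j).1) * m.len j ^ 2 := fun j hj =>
        (ht j).resolve_left (Finset.mem_filter.1 hj).2
      have hsum : ∑ j ∈ J, m.len j / ((t j).2 - (t j).1) ≤ ((p : ℝ) + 1) ^ 2 := by
        rw [← Finset.sum_fiberwise_of_maps_to (fun j hj => (hgood j hj).1)]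
        calc ∑ s ∈ insert 0 S ×ˢ insert 1 S, ∑ j ∈ J with t j = s,
              m.len j / ((t j).2 - (t j).1)
            ≤ ∑ _s ∈ insert (0 : ℝ) S ×ˢ insert (1 : ℝ) S, (1 : ℝ) := by
              refine Finset.sum_le_sum fun s _ => ?_
              rcases (J.filter fun j => t j = s).eq_empty_or_nonempty with h0 | ⟨i, hi⟩
              · rw [h0, Finset.sum_empty]; exact zero_le_one
              obtain ⟨hiJ, his⟩ := Finset.mem_filter.1 hi
              have hs : 0 < s.2 - s.1 := by
                have := (hgood i hiJ).2.2.1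
                rw [his] at this
                exact (m.len_pos i).trans_le this
              have hcongr : ∑ j ∈ J with t j = s, m.len j / ((t j).2 - (t j).1) =
                  (∑ j ∈ J with t j = s, m.len j) / (s.2 - s.1) := by
                rw [Finset.sum_div]
                refine Finset.sum_congr rfl fun j hj => ?_
                rw [(Finset.mem_filter.1 hj).2]
              rw [hcongr, div_le_one hs]
              refine m.sum_len_le _ (sub_pos.1 hs).le fun j hj => ?_
              obtain ⟨hjJ, hjs⟩ := Finset.mem_filter.1 hj
              have := (hgood j hjJ).2.1
              rwa [hjs] at this
          _ = ((insert (0 : ℝ) S).card : ℝ) * ((insert (1 : ℝ) S).card : ℝ) := by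
              rw [Finset.sum_const, Finset.card_product, nsmul_eq_mul]
              push_cast
              ring
          _ ≤ ((p : ℝ) + 1) * ((p : ℝ) + 1) := by
              have h1 : (insert (0 : ℝ) S).card ≤ p + 1 :=
                (Finset.card_insert_le _ _).trans (by omega)
              have h2 : (insert (1 : ℝ) S).card ≤ p + 1 :=
                (Finset.card_insert_le _ _).trans (by omega)
              gcongr
              · exact_mod_cast h1
              · exact_mod_cast h2
          _ = _ := by ring
      calc ∑ j ∈ J, m.len j * e j ^ 2
          ≤ ∑ j ∈ J, K ^ 2 * m.h ^ 3 * (m.len j / ((t j).2 - (t j).1)) := by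
            refine Finset.sum_le_sum fun j hj => ?_
            obtain ⟨-, -, hle, he⟩ := hgood j hj
            have hpos := m.len_pos j
            have hd : 0 < (t j).2 - (t j).1 := hpos.trans_le hle
            have hlh := m.len_le_h j
            have hratio : m.len j / ((t j).2 - (t j).1) ≤ 1 := (div_le_one hd).2 hle
            have hr0 : 0 ≤ m.len j / ((t j).2 - (t j).1) := by positivity
            rw [he]
            calc m.len j * (K / ((t j).2 - (t j).1) * m.len j ^ 2) ^ 2
                = K ^ 2 * m.len j ^ 3 * (m.len j / ((t j).2 - (t j).1)) *
                    (m.len j / ((t j).2 - (t j).1)) := by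
                  field_simp
              _ ≤ K ^ 2 * m.h ^ 3 * (m.len j / ((t j).2 - (t j).1)) * 1 := by gcongr
              _ = _ := mul_one _
        _ = K ^ 2 * m.h ^ 3 * ∑ j ∈ J, m.len j / ((t j).2 - (t j).1) := by
            rw [Finset.mul_sum]
        _ ≤ K ^ 2 * m.h ^ 3 * ((p : ℝ) + 1) ^ 2 := by gcongr
        _ = _ := by ring
  · have hrate : rateExp k ℓ = 1 := by
      have h1 : min (k : ℝ) ℓ = 0 := by
        rcases not_and_or.1 hkl with h | h
        · rw [show k = 0 by omega, Nat.cast_zero]; exact min_eq_left (Nat.cast_nonneg ℓ)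
        · rw [show ℓ = 0 by omega, Nat.cast_zero]; exact min_eq_right (Nat.cast_nonneg k)
      rw [rateExp, h1]
      norm_num
    refine ⟨Λ, hΛ, fun S w _ hw N m => ?_⟩
    obtain ⟨P, hP, hPR⟩ := exists_mem_DGSpace m k (fun j => C (w (m.pt j.castSucc))) (by simp)
    refine ⟨P, hP, fun j => Λ * m.len j, fun j x hx => ?_, ?_⟩
    · rw [hPR j x hx]
      exact abs_sub_const_le hΛ hw m j x hx
    · have hh := m.h_pos
      rw [hrate, Real.rpow_one]
      refine Real.sqrt_le_iff.2 ⟨by positivity, ?_⟩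
      calc ∑ j, m.len j * (Λ * m.len j) ^ 2 ≤ ∑ j, m.len j * (Λ * m.h) ^ 2 := by
            refine Finset.sum_le_sum fun j _ => ?_
            have h1 := m.len_le_h j
            have h2 := (m.len_pos j).le
            gcongr
        _ = (∑ j, m.len j) * (Λ * m.h) ^ 2 := by rw [Finset.sum_mul]
        _ ≤ 1 * (Λ * m.h) ^ 2 := by
            have := m.sum_len_le_one
            gcongr
        _ = _ := one_mul _

/-! ### Translates of the solution -/

theorem abs_sub_le_of_piecewiseClass {ℓ p : ℕ} {L c₀ : ℝ} {v : ℝ → ℝ} (hc : Continuous v)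
    (hp : Function.Periodic v 1) (hv : PiecewiseClass ℓ p L c₀ v) {x y : ℝ} (hxy : |x - y| ≤ 1) :
    |v x - v y| ≤ |L| * |x - y| := by
  have hcl : ∀ x ∈ Icc (0 : ℝ) 1, ∀ y ∈ Icc (0 : ℝ) 1, |v x - v y| ≤ |L| * |x - y| := by
    have hclosed : IsClosed {z : ℝ × ℝ | |v z.1 - v z.2| ≤ |L| * |z.1 - z.2|} :=
      isClosed_le (by fun_prop) (by fun_prop)
    have hsub : closure (Ioo (0 : ℝ) 1 ×ˢ Ioo (0 : ℝ) 1) ⊆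
        {z : ℝ × ℝ | |v z.1 - v z.2| ≤ |L| * |z.1 - z.2|} := by
      refine closure_minimal (fun z hz => ?_) hclosed
      exact (hv.1 _ hz.1 _ hz.2).trans
        (mul_le_mul_of_nonneg_right (le_abs_self L) (abs_nonneg _))
    rw [closure_prod_eq, closure_Ioo zero_ne_one] at hsub
    exact fun x hx y hy => hsub (mk_mem_prod hx hy)
  wlog hle : x ≤ y generalizing x y
  · rw [abs_sub_comm (v x), abs_sub_comm x]
    exact this (by rwa [abs_sub_comm]) (le_of_not_ge hle)
  rw [abs_sub_comm x, abs_of_nonneg (sub_nonneg.2 hle)] at hxy ⊢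
  have hper : ∀ z : ℝ, v (z - ⌊x⌋) = v z := fun z => by
    have := hp.sub_zsmul_eq (x := z) ⌊x⌋
    rwa [zsmul_one] at this
  rw [← hper x, ← hper y]
  have hx0 : 0 ≤ x - ⌊x⌋ := Int.fract_nonneg x
  have hx1 : x - ⌊x⌋ < 1 := Int.fract_lt_one x
  have hcl' : ∀ x ∈ Icc (0 : ℝ) 1, ∀ y ∈ Icc (0 : ℝ) 1, x ≤ y → |v x - v y| ≤ |L| * (y - x) := by
    intro x hx y hy hxy
    have := hcl x hx y hy
    rwa [abs_sub_comm x, abs_of_nonneg (sub_nonneg.2 hxy)] at this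
  rcases le_total (y - ⌊x⌋) 1 with h | h
  · refine (hcl' _ ⟨hx0, hx1.le⟩ _ ⟨by linarith, h⟩ (by linarith)).trans_eq ?_
    ring
  · have h1 := hcl' _ ⟨hx0, hx1.le⟩ 1 ⟨zero_le_one, le_rfl⟩ hx1.le
    have h2 := hcl' 0 ⟨le_rfl, zero_le_one⟩ (y - ⌊x⌋ - 1) ⟨by linarith, by linarith⟩
      (by linarith)
    have e1 : v 1 = v 0 := by simpa using hp 0
    rw [hp.sub_eq, ← e1] at h2
    have h3 := abs_sub_le (v (x - ⌊x⌋)) (v 1) (v (y - ⌊x⌋))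
    linarith

/-- Translates of a periodic function of the piecewise class: the singular points are translated
modulo one, and the end point of the period becomes a further one. -/
theorem exists_smoothOff_comp_sub {ℓ p : ℕ} {L c₀ : ℝ} {v : ℝ → ℝ} (hc : Continuous v)
    (hp : Function.Periodic v 1) (hv : PiecewiseClass ℓ p L c₀ v) (a : ℝ) :
    ∃ S : Finset ℝ, S.card ≤ 2 * p + 1 ∧ SmoothOff ℓ |L| |c₀| S (fun x => v (x - a)) := by
  classical
  obtain ⟨S, hS, hdiff, hbd⟩ := hv.2
  set f := Int.fract a with hf
  have hf0 : 0 ≤ f := Int.fract_nonneg a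
  have hf1 : f < 1 := Int.fract_lt_one a
  have hw1 : (fun x => v (x - a)) = fun x => v (x - f) := by
    funext x
    have := hp.sub_zsmul_eq (x := x - f) ⌊a⌋
    rw [zsmul_one] at this
    rw [← this]
    congr 1
    have := Int.fract_add_floor a
    rw [← hf] at this
    linarith
  have hw2 : (fun x => v (x - a)) = fun x => v (x - (f - 1)) := by
    rw [hw1]
    funext x
    rw [← hp (x - f)]
    congr 1
    ring
  have hopen : IsOpen (Ioo (0 : ℝ) 1 \ (S : Set ℝ)) :=
    isOpen_Ioo.sdiff S.finite_toSet.isClosed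
  have key : ∀ b x : ℝ, x - b ∈ Ioo (0 : ℝ) 1 \ (S : Set ℝ) →
      ContDiffAt ℝ ((ℓ + 1 : ℕ) : WithTop ℕ∞) (fun x => v (x - b)) x ∧
        |iteratedDeriv (ℓ + 1) (fun x => v (x - b)) x| ≤ |c₀| := by
    intro b x hx
    constructor
    · have h1 := hdiff.contDiffAt (hopen.mem_nhds hx)
      exact h1.comp x (contDiff_id.sub contDiff_const).contDiffAt
    · rw [iteratedDeriv_comp_sub_const]
      exact (hbd _ hx).trans (le_abs_self _)
  refine ⟨insert f (S.image (fun s => s + f) ∪ S.image fun s => s + (f - 1)), ?_, ?_, ?_⟩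
  · refine (Finset.card_insert_le _ _).trans ?_
    have h1 := Finset.card_union_le (S.image fun s => s + f) (S.image fun s => s + (f - 1))
    have h2 := Finset.card_image_le (s := S) (f := fun s => s + f)
    have h3 := Finset.card_image_le (s := S) (f := fun s => s + (f - 1))
    omega
  · intro x y hxy
    have e : x - a - (y - a) = x - y := by ring
    have := abs_sub_le_of_piecewiseClass hc hp hv (x := x - a) (y := y - a) (by rwa [e])
    rwa [e] at this
  · intro x hx hxS
    simp only [Finset.mem_insert, Finset.mem_union, Finset.mem_image, not_or, not_exists,
      not_and] at hxS
    obtain ⟨hxf, hxS1, hxS2⟩ := hxS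
    rcases lt_or_gt_of_ne hxf with h | h
    · rw [hw2]
      exact key _ x ⟨⟨by linarith [hx.1], by linarith⟩, fun hs => hxS2 _ hs (by ring)⟩
    · rw [hw1]
      exact key _ x ⟨⟨by linarith, by linarith [hx.2]⟩, fun hs => hxS1 _ hs (by ring)⟩

/-! ### The error recursion -/

/-- The error of the scheme grows by at most the approximation errors of one step and the discrete
distance between the numerical and the exact obstacle. -/
theorem exists_error_bound (k ℓ p : ℕ) (L c₀ : ℝ) (Q : GaussLegendre k) :
    ∃ K : ℝ, 0 ≤ K ∧ ∀ (c : ℝ) (g u₀ : ℝ → ℝ) (u : ℝ → ℝ → ℝ) (T : ℝ),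
      Continuous g → IsViscositySolution c g u₀ u → NotShattering ℓ p L c₀ T u →
      ∀ (N : ℕ) (m : Mesh N) (dt : ℝ) (gt : ℝ → ℝ) (uh : ℕ → ℝ → ℝ), 0 < dt →
        IsSLDGObstacleScheme m Q c dt u₀ gt uh → ∀ n : ℕ, n * dt ≤ T →
          l2Norm (fun x => uh n x - u (n * dt) x) ≤
            (4 * n + 2) * (K * m.h ^ rateExp k ℓ) +
              n * discreteNorm m Q (fun x => gt x - obstacleMax c g dt x) := by
  obtain ⟨K, hK, happ⟩ := exists_DGSpace_approx k ℓ (2 * p + 1) (abs_nonneg L) (abs_nonneg c₀)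
  refine ⟨K, hK, fun c g u₀ u T hg hu hns N m dt gt uh hdt hs n hn => ?_⟩
  set ε := K * m.h ^ rateExp k ℓ with hε
  set D := discreteNorm m Q (fun x => gt x - obstacleMax c g dt x) with hD
  have ht0 : ∀ i : ℕ, (0 : ℝ) ≤ i * dt := fun i => by positivity
  have hcont : ∀ i : ℕ, Continuous (u (i * dt)) := fun i => hu.continuous_slice (ht0 i)
  have hshift : ∀ i : ℕ, (i : ℝ) * dt ≤ T → ∀ a : ℝ, ∃ P ∈ DGSpace m k, ∃ e : Fin N → ℝ,
      (∀ j, ∀ x ∈ m.cell j, |u (i * dt) (x - a) - P x| ≤ e j) ∧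
        √(∑ j, m.len j * e j ^ 2) ≤ ε := by
    intro i hi a
    obtain ⟨S, hS, hsm⟩ := exists_smoothOff_comp_sub (hcont i) (hu.periodic _ (ht0 i))
      (hns _ ⟨ht0 i, hi⟩) a
    exact happ S _ hS hsm N m
  have huh : ∀ i, uh i ∈ DGSpace m k := by
    rintro (_ | i)
    · exact hs.initial.1
    · obtain ⟨G, -, h, -⟩ := hs.step i
      exact h
  -- The error is measured against an arbitrary approximant `P` of the exact solution.
  have main : ∀ i : ℕ, (i : ℝ) * dt ≤ T → ∀ P ∈ DGSpace m k, ∀ e : Fin N → ℝ,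
      (∀ j, ∀ x ∈ m.cell j, |u (i * dt) x - P x| ≤ e j) → √(∑ j, m.len j * e j ^ 2) ≤ ε →
        l2Norm (fun x => uh i x - P x) ≤ (4 * i + 1) * ε + i * D := by
    intro i
    induction i with
    | zero =>
      intro _ P hP e he hee
      have h0 : u ((0 : ℕ) * dt) = u₀ := by
        funext x
        rw [Nat.cast_zero, zero_mul, hu.initial]
      have hc0 := hcont 0
      rw [h0] at he hc0
      have h1 := hs.initial.l2Norm_sub_le (memLp_of_continuous hc0) hP
      have h2 := l2Norm_le_of_abs_le m ((memLp_of_continuous hc0).sub (memLp_of_mem_DGSpace hP)) he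
      simp only [Nat.cast_zero]
      have h3 := h1.trans (h2.trans hee)
      linarith
    | succ i ih =>
      intro hi P hP e he hee
      have hcast : ((i + 1 : ℕ) : ℝ) * dt = i * dt + dt := by push_cast; ring
      have hi' : (i : ℝ) * dt ≤ T := by linarith
      obtain ⟨G, hG, hmem, hval⟩ := hs.step i
      obtain ⟨P', hP', e', he', hee'⟩ := hshift i hi' 0
      simp only [sub_zero] at he'
      obtain ⟨R, hR, r, hr, hrr⟩ := hshift i hi' (c * dt)
      have hIH := ih hi' P' hP' e' he' hee'
      have hper := hu.periodic _ (ht0 i)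
      have hdiffper : Function.Periodic (fun x => uh i x - u (i * dt) x) 1 := fun x => by
        simp only [(huh i).1 x, hper x]
      have hcL := memLp_of_continuous (hcont i)
      have hstep : l2Norm (fun x => uh i x - u (i * dt) x) ≤ (4 * i + 2) * ε + i * D := by
        have h1 := l2Norm_add_le (f := fun x => uh i x - P' x) (g := fun x => P' x - u (i * dt) x)
          ((memLp_of_mem_DGSpace (huh i)).sub (memLp_of_mem_DGSpace hP'))
          ((memLp_of_mem_DGSpace hP').sub hcL)
        simp only [sub_add_sub_cancel] at h1
        have h2 := l2Norm_le_of_abs_le m ((memLp_of_mem_DGSpace hP').sub hcL)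
          (e := e') fun j x hx => by
            rw [Pi.sub_apply, abs_sub_comm]; exact he' j x hx
        have h3 := h2.trans hee'
        have h4 : l2Norm (fun x => P' x - u (i * dt) x) ≤ ε := h3
        linarith
      -- The projection step: compare `G` with the approximant `R` of the translated solution.
      have hshL : MemLp (fun x => u (i * dt) (x - c * dt)) 2
          (volume.restrict (Ioo (0 : ℝ) 1)) := memLp_comp_sub_of_periodic hper hcL _
      have huL : MemLp (fun x => uh i (x - c * dt)) 2 (volume.restrict (Ioo (0 : ℝ) 1)) :=
        memLp_comp_sub_of_periodic (huh i).1 (memLp_of_mem_DGSpace (huh i)) _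
      have hGR : l2Norm (fun x => G x - R x) ≤ (4 * i + 3) * ε + i * D := by
        have h1 := hG.l2Norm_sub_le huL hR
        have h2 := l2Norm_add_le (f := fun x => uh i (x - c * dt) - u (i * dt) (x - c * dt))
          (g := fun x => u (i * dt) (x - c * dt) - R x) (huL.sub hshL)
          (hshL.sub (memLp_of_mem_DGSpace hR))
        simp only [sub_add_sub_cancel] at h2
        have h3 := l2Norm_comp_sub hdiffper (c * dt)
        have h4 : l2Norm (fun x => u (i * dt) (x - c * dt) - R x) ≤ ε :=
          (l2Norm_le_of_abs_le m (hshL.sub (memLp_of_mem_DGSpace hR)) hr).trans hrr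
        linarith
      rw [← discreteNorm_eq_l2Norm Q (sub_mem_DGSpace hG.1 hR)] at hGR
      rw [← discreteNorm_eq_l2Norm Q (sub_mem_DGSpace hmem hP)]
      have d1 : discreteNorm m Q (fun x => uh (i + 1) x - P x) ≤
          discreteNorm m Q (fun x => uh (i + 1) x - u ((i + 1 : ℕ) * dt) x) +
            discreteNorm m Q (fun x => u ((i + 1 : ℕ) * dt) x - P x) :=
        discreteNorm_le_add fun j a => abs_sub_le _ _ _
      have d2 : discreteNorm m Q (fun x => u ((i + 1 : ℕ) * dt) x - P x) ≤ ε :=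
        (discreteNorm_le_of_abs_le he).trans hee
      have d3 : discreteNorm m Q (fun x => uh (i + 1) x - u ((i + 1 : ℕ) * dt) x) ≤
          discreteNorm m Q (fun x => G x - u (i * dt) (x - c * dt)) + D := by
        refine discreteNorm_le_add fun j a => ?_
        rw [hval j a, hcast, hu.eq_max hg (ht0 i) hdt.le]
        exact (abs_max_sub_max_le_max _ _ _ _).trans
          (max_le_add_of_nonneg (abs_nonneg _) (abs_nonneg _))
      have d4 : discreteNorm m Q (fun x => G x - u (i * dt) (x - c * dt)) ≤
          discreteNorm m Q (fun x => G x - R x) +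
            discreteNorm m Q (fun x => u (i * dt) (x - c * dt) - R x) :=
        discreteNorm_le_add fun j a => by
          rw [abs_sub_comm (u _ _)]; exact abs_sub_le _ _ _
      have d5 : discreteNorm m Q (fun x => u (i * dt) (x - c * dt) - R x) ≤ ε :=
        (discreteNorm_le_of_abs_le hr).trans hrr
      push_cast
      linarith
  obtain ⟨P, hP, e, he, hee⟩ := hshift n hn 0
  simp only [sub_zero] at he
  have h1 := main n hn P hP e he hee
  have hcL := memLp_of_continuous (hcont n)
  have h2 := l2Norm_add_le (f := fun x => uh n x - P x) (g := fun x => P x - u (n * dt) x)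
    ((memLp_of_mem_DGSpace (huh n)).sub (memLp_of_mem_DGSpace hP))
    ((memLp_of_mem_DGSpace hP).sub hcL)
  simp only [sub_add_sub_cancel] at h2
  have h3 : l2Norm (fun x => P x - u (n * dt) x) ≤ ε :=
    (l2Norm_le_of_abs_le m ((memLp_of_mem_DGSpace hP).sub hcL)
      (e := e) fun j x hx => by
        rw [Pi.sub_apply, abs_sub_comm]; exact he j x hx).trans hee
  linarith

/-- The bound in terms of `T / dt`, which dominates both the number of steps and one. -/
theorem exists_general_bound (k ℓ p : ℕ) (L c₀ : ℝ) (Q : GaussLegendre k) :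
    ∃ C : ℝ, 0 ≤ C ∧ ∀ (c : ℝ) (g u₀ : ℝ → ℝ) (u : ℝ → ℝ → ℝ) (T : ℝ), 0 < c →
      Continuous g → Function.Periodic g 1 → IsViscositySolution c g u₀ u →
      0 < T → NotShattering ℓ p L c₀ T u →
      ∀ (N : ℕ) (m : Mesh N) (dt : ℝ) (gt : ℝ → ℝ) (uh : ℕ → ℝ → ℝ), 0 < dt → dt ≤ T →
        IsSLDGObstacleScheme m Q c dt u₀ gt uh →
        ∀ n : ℕ, n * dt ≤ T →
          l2Norm (fun x => uh n x - u (n * dt) x) ≤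
            C * T * (m.h ^ rateExp k ℓ / dt) +
            C * T * (discreteNorm m Q (fun x => gt x - obstacleMax c g dt x) / dt) := by
  obtain ⟨K, hK, hbd⟩ := exists_error_bound k ℓ p L c₀ Q
  refine ⟨6 * K + 1, by positivity,
    fun c g u₀ u T _ hg _ hu hT hns N m dt gt uh hdt hdtT hs n hn => ?_⟩
  have h := hbd c g u₀ u T hg hu hns N m dt gt uh hdt hs n hn
  set H := m.h ^ rateExp k ℓ with hH
  have hH0 : 0 ≤ H := Real.rpow_nonneg m.h_pos.le _
  set D := discreteNorm m Q (fun x => gt x - obstacleMax c g dt x) with hD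
  have hD0 : 0 ≤ D := discreteNorm_nonneg _
  set τ := T / dt with hτ
  have hn' : (n : ℝ) ≤ τ := (le_div_iff₀ hdt).2 hn
  have h1 : 1 ≤ τ := (one_le_div hdt).2 hdtT
  calc _ ≤ (4 * n + 2) * (K * H) + n * D := h
    _ ≤ (4 * τ + 2 * τ) * (K * H) + τ * D := by
        have : (2 : ℝ) ≤ 2 * τ := by linarith
        gcongr
    _ ≤ (6 * K + 1) * (τ * H) + (6 * K + 1) * (τ * D) := by
        have h2 : 0 ≤ τ * H := by positivity
        have h3 : 0 ≤ τ * D := by positivity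
        have h4 : 0 ≤ K * (τ * D) := by positivity
        nlinarith
    _ = _ := by
        rw [hτ]
        field_simp

/-! ### The two-point obstacle -/

theorem isLocalMax_sub_int {g : ℝ → ℝ} (hp : Function.Periodic g 1) {y : ℝ} (h : IsLocalMax g y)
    (n : ℤ) : IsLocalMax g (y - n) := by
  have hper : ∀ z : ℝ, g (z + n) = g z := fun z => by
    have := hp.zsmul n z
    rwa [zsmul_one] at this
  have ht : Filter.Tendsto (fun z : ℝ => z + n) (𝓝 (y - n)) (𝓝 y) := by
    have := (continuous_add_const (n : ℝ)).tendsto (y - n)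
    rwa [sub_add_cancel] at this
  filter_upwards [ht.eventually h] with z hz
  rw [hper] at hz
  rw [← hper (y - n), sub_add_cancel]
  exact hz

/-- Near a maximum where it is twice differentiable, a bounded function falls off at most
quadratically, and then so globally. -/
theorem exists_quadratic_bound_at {g : ℝ → ℝ} {B : ℝ} (hB : ∀ x, |g x| ≤ B) {y : ℝ}
    (hmax : IsLocalMax g y) (hd : ∀ᶠ x in 𝓝 y, DifferentiableAt ℝ g x)
    (hd2 : DifferentiableAt ℝ (deriv g) y) :
    ∃ K : ℝ, 0 ≤ K ∧ ∀ x, g y - g x ≤ K * (x - y) ^ 2 := by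
  obtain ⟨M, hM⟩ := hd2.isBigO_sub.bound
  rw [hmax.deriv_eq_zero] at hM
  obtain ⟨δ, hδ, hball⟩ := Metric.eventually_nhds_iff_ball.1 (hd.and hM)
  have hB0 : 0 ≤ B := (abs_nonneg _).trans (hB y)
  refine ⟨|M| + 2 * B / δ ^ 2, by positivity, fun x => ?_⟩
  rw [add_mul]
  have hn1 : 0 ≤ |M| * (x - y) ^ 2 := by positivity
  have hn2 : 0 ≤ 2 * B / δ ^ 2 * (x - y) ^ 2 := by positivity
  rcases lt_or_ge |x - y| δ with h | h
  · have hsub : Metric.closedBall y |x - y| ⊆ Metric.ball y δ :=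
      Metric.closedBall_subset_ball h
    have hx : x ∈ Metric.closedBall y |x - y| := by
      rw [Metric.mem_closedBall, Real.dist_eq]
    have hmvt := (convex_closedBall y |x - y|).norm_image_sub_le_of_norm_deriv_le (f := g)
      (C := |M| * |x - y|) (fun z hz => (hball z (hsub hz)).1) (fun z hz => by
        have h1 := (hball z (hsub hz)).2
        rw [sub_zero] at h1
        refine h1.trans ?_
        rw [Metric.mem_closedBall, Real.dist_eq] at hz
        exact mul_le_mul (le_abs_self M) hz (norm_nonneg _) (abs_nonneg _)) hx
      (Metric.mem_closedBall_self (abs_nonneg _))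
    rw [Real.norm_eq_abs, Real.norm_eq_abs, abs_sub_comm y x, mul_assoc, ← sq, sq_abs] at hmvt
    have := le_abs_self (g y - g x)
    linarith
  · have h1 : 2 * B ≤ 2 * B / δ ^ 2 * (x - y) ^ 2 := by
      have : δ ^ 2 ≤ (x - y) ^ 2 := by rw [← sq_abs (x - y)]; gcongr
      rw [div_mul_eq_mul_div, le_div_iff₀ (by positivity)]
      gcongr
    have h2 := (abs_le.1 (hB y)).2
    have h3 := (abs_le.1 (hB x)).1
    linarith

theorem exists_abs_le_of_periodic {g : ℝ → ℝ} (hg : Continuous g) (hp : Function.Periodic g 1) :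
    ∃ B : ℝ, ∀ x, |g x| ≤ B := by
  obtain ⟨B, hB⟩ := (isCompact_Icc (a := (0 : ℝ)) (b := 1)).bddAbove_image
    (f := fun x => |g x|) (by fun_prop)
  refine ⟨B, fun x => ?_⟩
  obtain ⟨y, hy, hxy⟩ := hp.exists_mem_Ico₀ one_pos x
  rw [hxy]
  exact hB ⟨y, Ico_subset_Icc_self hy, rfl⟩

theorem DeltaTwo.exists_quadratic_bound {q : ℕ} {g : ℝ → ℝ} (h : DeltaTwo q g)
    (hg : Continuous g) (hp : Function.Periodic g 1) :
    ∃ K : ℝ, 0 ≤ K ∧ ∀ y, IsLocalMax g y → ∀ x, g y - g x ≤ K * (x - y) ^ 2 := by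
  obtain ⟨B, hB⟩ := exists_abs_le_of_periodic hg hp
  have hfin : {x ∈ Ico (0 : ℝ) 1 | IsLocalMax g x}.Finite := by
    rw [← Set.encard_lt_top_iff]
    exact h.1.trans_lt (ENat.natCast_lt_top q)
  have hloc : ∀ y, ∃ K : ℝ, 0 ≤ K ∧ (IsLocalMax g y → ∀ x, g y - g x ≤ K * (x - y) ^ 2) := by
    intro y
    by_cases hy : IsLocalMax g y
    · obtain ⟨K, hK, hKx⟩ := exists_quadratic_bound_at hB hy (h.2 y hy).1 (h.2 y hy).2
      exact ⟨K, hK, fun _ => hKx⟩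
    · exact ⟨0, le_rfl, fun h => absurd h hy⟩
  choose K hK hKx using hloc
  refine ⟨∑ y ∈ hfin.toFinset, K y, Finset.sum_nonneg fun y _ => hK y, fun y hy x => ?_⟩
  have hper : ∀ z : ℝ, g (z - ⌊y⌋) = g z := fun z => by
    have := hp.sub_zsmul_eq (x := z) ⌊y⌋
    rwa [zsmul_one] at this
  have hy' := isLocalMax_sub_int hp hy ⌊y⌋
  have hmem : y - ⌊y⌋ ∈ hfin.toFinset := by
    rw [Set.Finite.mem_toFinset]
    exact ⟨⟨Int.fract_nonneg y, Int.fract_lt_one y⟩, hy'⟩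
  have h1 := hKx _ hy' (x - ⌊y⌋)
  rw [hper, hper, sub_sub_sub_cancel_right] at h1
  exact h1.trans (mul_le_mul_of_nonneg_right
    (Finset.single_le_sum (fun z _ => hK z) hmem) (sq_nonneg _))

/-- The two-point obstacle differs from the running maximum only if the latter is attained at a
local maximum point strictly between the two points. -/
theorem obstacleTwoPoint_eq_or {c : ℝ} {g : ℝ → ℝ} (hc : 0 < c) (hg : Continuous g) {dt : ℝ}
    (hdt : 0 < dt) (x : ℝ) : obstacleTwoPoint c g dt x = obstacleMax c g dt x ∨
      ∃ y ∈ Ioo (x - c * dt) x, IsLocalMax g y ∧ obstacleMax c g dt x = g y ∧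
        obstacleTwoPoint c g dt x ≤ obstacleMax c g dt x := by
  have h0 : g x ≤ obstacleMax c g dt x := by
    simpa using le_obstacleMax (c := c) hg (x := x) (left_mem_Icc.2 hdt.le)
  have h1 : g (x - c * dt) ≤ obstacleMax c g dt x :=
    le_obstacleMax (c := c) hg (x := x) (right_mem_Icc.2 hdt.le)
  have hle : obstacleTwoPoint c g dt x ≤ obstacleMax c g dt x := max_le h0 h1
  obtain ⟨θ, hθ, hθmax⟩ := (isCompact_Icc (a := (0 : ℝ)) (b := dt)).exists_sSup_image_eq
    (nonempty_Icc.2 hdt.le) (f := fun θ => g (x - c * θ)) (by fun_prop)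
  change obstacleMax c g dt x = g (x - c * θ) at hθmax
  rcases eq_or_lt_of_le hθ.1 with rfl | hθ0
  · left
    refine le_antisymm hle ?_
    rw [hθmax, mul_zero, sub_zero]
    exact le_max_left _ _
  rcases eq_or_lt_of_le hθ.2 with rfl | hθ1
  · left
    refine le_antisymm hle ?_
    rw [hθmax]
    exact le_max_right _ _
  · right
    have hmem : x - c * θ ∈ Ioo (x - c * dt) x := ⟨by nlinarith, by nlinarith⟩
    refine ⟨x - c * θ, hmem, ?_, hθmax, hle⟩
    filter_upwards [Ioo_mem_nhds hmem.1 hmem.2] with z hz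
    rw [← hθmax]
    have h2 := le_obstacleMax (c := c) hg (x := x) (t := dt) (θ := (x - z) / c)
      ⟨div_nonneg (by linarith [hz.2]) hc.le, (div_le_iff₀ hc).2 (by linarith [hz.1])⟩
    rwa [mul_div_cancel₀ _ hc.ne', sub_sub_cancel] at h2

/-- The cells which meet an interval of length `d` following one of the local maximum points have
total length `O(d + h)`. -/
theorem sum_len_near_localMax_le {q : ℕ} {g : ℝ → ℝ} (hp : Function.Periodic g 1)
    (hq : {x ∈ Ico (0 : ℝ) 1 | IsLocalMax g x}.encard ≤ q) {N : ℕ} (m : Mesh N) {d : ℝ}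
    (hd : 0 < d) (J : Finset (Fin N))
    (hJ : ∀ j ∈ J, ∃ x ∈ m.cell j, ∃ y ∈ Ioo (x - d) x, IsLocalMax g y) :
    ∑ j ∈ J, m.len j ≤ (2 * q + 1) * (d + 2 * m.h) := by
  classical
  have hh := m.h_pos
  have hq0 : (0 : ℝ) ≤ q := Nat.cast_nonneg q
  rcases le_total 1 d with h1 | h1
  · have h2 : ∑ j ∈ J, m.len j ≤ 1 :=
      (Finset.sum_le_sum_of_subset_of_nonneg (Finset.subset_univ J)
        fun j _ _ => (m.len_pos j).le).trans m.sum_len_le_one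
    nlinarith [mul_nonneg hq0 hd.le, mul_nonneg hq0 hh.le]
  have hfin : {x ∈ Ico (0 : ℝ) 1 | IsLocalMax g x}.Finite := by
    rw [← Set.encard_lt_top_iff]
    exact hq.trans_lt (ENat.natCast_lt_top q)
  set M := hfin.toFinset with hM
  have hMcard : M.card ≤ q := by
    rw [hfin.encard_eq_coe_toFinset_card] at hq
    exact_mod_cast hq
  set M' := M ∪ M.image (fun y => y - 1) with hM'
  have hM'card : M'.card ≤ 2 * q := by
    have h2 := Finset.card_union_le M (M.image fun y => y - 1)
    have h3 := Finset.card_image_le (s := M) (f := fun y => y - 1)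
    rw [← hM'] at h2
    omega
  have hJM : ∀ j ∈ J, ∃ y ∈ M', ∃ x ∈ m.cell j, y ∈ Ioo (x - d) x := by
    intro j hj
    obtain ⟨x, hx, y, hy, hmax⟩ := hJ j hj
    have hx' := m.cell_subset j hx
    refine ⟨y, ?_, x, hx, hy⟩
    rcases le_or_gt 0 y with h | h
    · refine Finset.mem_union_left _ ((Set.Finite.mem_toFinset _).2 ⟨⟨h, ?_⟩, hmax⟩)
      linarith [hy.2, hx'.2]
    · refine Finset.mem_union_right _ (Finset.mem_image.2 ⟨y + 1, ?_, by ring⟩)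
      refine (Set.Finite.mem_toFinset _).2 ⟨⟨by linarith [hy.1, hx'.1], by linarith⟩, ?_⟩
      have := isLocalMax_sub_int hp hmax (-1)
      simpa using this
  calc ∑ j ∈ J, m.len j
      ≤ ∑ j ∈ J, ∑ y ∈ M', if ∃ x ∈ m.cell j, y ∈ Ioo (x - d) x then m.len j else 0 := by
        refine Finset.sum_le_sum fun j hj => ?_
        obtain ⟨y, hy, hxy⟩ := hJM j hj
        refine le_trans ?_ (Finset.single_le_sum (fun z _ => ?_) hy)
        · rw [if_pos hxy]
        · split_ifs
          · exact (m.len_pos j).le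
          · exact le_rfl
    _ = ∑ y ∈ M', ∑ j ∈ J with ∃ x ∈ m.cell j, y ∈ Ioo (x - d) x, m.len j := by
        rw [Finset.sum_comm]
        simp only [Finset.sum_filter]
    _ ≤ ∑ _y ∈ M', (d + 2 * m.h) := by
        refine Finset.sum_le_sum fun y _ => ?_
        refine (m.sum_len_le _ (a := y - m.h) (b := y + d + m.h) (by linarith)
          fun j hj z hz => ?_).trans_eq (by ring)
        obtain ⟨x, hx, hxy⟩ := (Finset.mem_filter.1 hj).2
        have hlen := m.len_le_h j
        rw [Mesh.len] at hlen
        constructor <;> linarith [hx.1, hx.2, hz.1, hz.2, hxy.1, hxy.2]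
    _ = M'.card * (d + 2 * m.h) := by rw [Finset.sum_const, nsmul_eq_mul]
    _ ≤ (2 * q + 1) * (d + 2 * m.h) := by
        have : (M'.card : ℝ) ≤ 2 * q := by exact_mod_cast hM'card
        gcongr
        linarith

theorem exists_discreteNorm_twoPoint_le {c : ℝ} {g : ℝ → ℝ} {q : ℕ} (hc : 0 < c)
    (hg : Continuous g) (hp : Function.Periodic g 1) (h : DeltaTwo q g) :
    ∃ K : ℝ, 0 ≤ K ∧ ∀ (k N : ℕ) (m : Mesh N) (Q : GaussLegendre k) (dt : ℝ), 0 < dt →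
      discreteNorm m Q (fun x => obstacleTwoPoint c g dt x - obstacleMax c g dt x) ≤
        K * (dt ^ 2 * √(dt + m.h)) := by
  classical
  obtain ⟨K, hK, hquad⟩ := h.exists_quadratic_bound hg hp
  refine ⟨K * c ^ 2 * √((2 * q + 1) * (c + 2)), by positivity, fun k N m Q dt hdt => ?_⟩
  have hh := m.h_pos
  set J := Finset.univ.filter fun j : Fin N =>
    ∃ x ∈ m.cell j, ∃ y ∈ Ioo (x - c * dt) x, IsLocalMax g y with hJ
  set e : Fin N → ℝ := fun j => if j ∈ J then K * (c * dt) ^ 2 else 0 with he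
  have hbound : ∀ j, ∀ x ∈ m.cell j,
      |obstacleTwoPoint c g dt x - obstacleMax c g dt x| ≤ e j := by
    intro j x hx
    have he0 : 0 ≤ e j := by
      simp only [he]
      split_ifs <;> positivity
    rcases obstacleTwoPoint_eq_or hc hg hdt x with heq | ⟨y, hy, hmax, hval, hle⟩
    · rw [heq, sub_self, abs_zero]
      exact he0
    · have hj : j ∈ J := Finset.mem_filter.2 ⟨Finset.mem_univ j, x, hx, y, hy, hmax⟩
      simp only [he, if_pos hj]
      rw [abs_sub_comm, abs_of_nonneg (sub_nonneg.2 hle), hval]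
      have h1 : g x ≤ obstacleTwoPoint c g dt x := le_max_left _ _
      have h2 := hquad y hmax x
      have h3 : (x - y) ^ 2 ≤ (c * dt) ^ 2 := by
        have : 0 ≤ x - y := by linarith [hy.2]
        gcongr
        linarith [hy.1]
      have h4 := mul_le_mul_of_nonneg_left h3 hK
      linarith
  have hsum : ∑ j ∈ J, m.len j ≤ (2 * q + 1) * (c * dt + 2 * m.h) :=
    sum_len_near_localMax_le hp h.1 m (by positivity) J fun j hj => (Finset.mem_filter.1 hj).2
  refine (discreteNorm_le_of_abs_le hbound).trans ?_
  refine Real.sqrt_le_iff.2 ⟨by positivity, ?_⟩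
  have hrhs : (K * c ^ 2 * √((2 * q + 1) * (c + 2)) * (dt ^ 2 * √(dt + m.h))) ^ 2 =
      (K * (c * dt) ^ 2) ^ 2 * ((2 * q + 1) * (c + 2) * (dt + m.h)) := by
    rw [mul_pow, mul_pow, mul_pow _ √(dt + m.h), Real.sq_sqrt (by positivity),
      Real.sq_sqrt (by positivity)]
    ring
  rw [hrhs]
  calc ∑ j, m.len j * e j ^ 2 = (K * (c * dt) ^ 2) ^ 2 * ∑ j ∈ J, m.len j := by
        rw [Finset.mul_sum, ← Finset.sum_filter_add_sum_filter_not Finset.univ (· ∈ J),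
          Finset.sum_eq_zero (s := Finset.univ.filter fun j => ¬ j ∈ J), add_zero]
        · rw [Finset.filter_mem_eq_inter, Finset.univ_inter]
          refine Finset.sum_congr rfl fun j hj => ?_
          simp only [he, if_pos hj]
          ring
        · intro j hj
          simp only [he, if_neg (Finset.mem_filter.1 hj).2]
          ring
    _ ≤ (K * (c * dt) ^ 2) ^ 2 * ((2 * q + 1) * (c * dt + 2 * m.h)) := by gcongr
    _ ≤ _ := by
        rw [mul_assoc (2 * (q : ℝ) + 1)]
        gcongr
        nlinarith

theorem exists_twoPoint_bound (k ℓ p : ℕ) (L c₀ : ℝ) (Q : GaussLegendre k) (c : ℝ) (g : ℝ → ℝ)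
    (q : ℕ) (hc : 0 < c) (hg : Continuous g) (hp : Function.Periodic g 1) (h : DeltaTwo q g) :
    ∃ C : ℝ, 0 ≤ C ∧ ∀ (u₀ : ℝ → ℝ) (u : ℝ → ℝ → ℝ) (T : ℝ),
      IsViscositySolution c g u₀ u → 0 < T → NotShattering ℓ p L c₀ T u →
      ∀ (N : ℕ) (m : Mesh N) (dt : ℝ) (uh : ℕ → ℝ → ℝ), 0 < dt → dt ≤ T →
        IsSLDGObstacleScheme m Q c dt u₀ (obstacleTwoPoint c g dt) uh →
        ∀ n : ℕ, n * dt ≤ T →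
          l2Norm (fun x => uh n x - u (n * dt) x) ≤
            C * T * (m.h ^ rateExp k ℓ / dt) + C * T * (dt * √(dt + m.h)) := by
  obtain ⟨C, hC, hgen⟩ := exists_general_bound k ℓ p L c₀ Q
  obtain ⟨K, hK, htwo⟩ := exists_discreteNorm_twoPoint_le hc hg hp h
  refine ⟨C * (1 + K), by positivity, fun u₀ u T hu hT hns N m dt uh hdt hdtT hs n hn => ?_⟩
  refine (hgen c g u₀ u T hc hg hp hu hT hns N m dt _ uh hdt hdtT hs n hn).trans ?_
  have hH : 0 ≤ m.h ^ rateExp k ℓ := Real.rpow_nonneg m.h_pos.le _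
  refine add_le_add ?_ ?_
  · have : C ≤ C * (1 + K) := by nlinarith
    gcongr
  · have h1 : discreteNorm m Q (fun x => obstacleTwoPoint c g dt x - obstacleMax c g dt x) / dt ≤
        K * (dt * √(dt + m.h)) := by
      rw [div_le_iff₀ hdt]
      exact (htwo k N m Q dt hdt).trans_eq (by ring)
    calc _ ≤ C * T * (K * (dt * √(dt + m.h))) := by gcongr
      _ = C * K * T * (dt * √(dt + m.h)) := by ring
      _ ≤ _ := by
          have : C * K ≤ C * (1 + K) := by nlinarith
          gcongr

/-- The choice `dt ∼ h ^ (3/5)` balances the two parts of the bound for the two-point obstacle. -/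
theorem balance_le {H dt α β : ℝ} (hH : 0 < H) (hH1 : H ≤ 1) (hα : 0 < α) (hβ : 0 ≤ β)
    (hdt : 0 < dt) (h1 : α * H ^ (3 / 5 : ℝ) ≤ dt) (h2 : dt ≤ β * H ^ (3 / 5 : ℝ)) :
    H ^ (3 / 2 : ℝ) / dt + dt * √(dt + H) ≤ (α⁻¹ + β * √(β + 1)) * H ^ (9 / 10 : ℝ) := by
  have hp : 0 < H ^ (3 / 5 : ℝ) := Real.rpow_pos_of_pos hH _
  have e1 : H ^ (3 / 2 : ℝ) = H ^ (9 / 10 : ℝ) * H ^ (3 / 5 : ℝ) := by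
    rw [← Real.rpow_add hH]; norm_num
  have e2 : H ^ (9 / 10 : ℝ) = H ^ (3 / 5 : ℝ) * √(H ^ (3 / 5 : ℝ)) := by
    rw [Real.sqrt_eq_rpow, ← Real.rpow_mul hH.le, ← Real.rpow_add hH]; norm_num
  have e3 : H ≤ H ^ (3 / 5 : ℝ) := by
    have := Real.rpow_le_rpow_of_exponent_ge hH hH1 (show (3 / 5 : ℝ) ≤ 1 by norm_num)
    rwa [Real.rpow_one] at this
  rw [add_mul]
  refine add_le_add ?_ ?_
  · rw [div_le_iff₀ hdt, e1]
    calc H ^ (9 / 10 : ℝ) * H ^ (3 / 5 : ℝ)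
        = α⁻¹ * H ^ (9 / 10 : ℝ) * (α * H ^ (3 / 5 : ℝ)) := by field_simp
      _ ≤ _ := by gcongr
  · have e4 : dt + H ≤ (β + 1) * H ^ (3 / 5 : ℝ) := by linarith
    calc dt * √(dt + H) ≤ β * H ^ (3 / 5 : ℝ) * √((β + 1) * H ^ (3 / 5 : ℝ)) := by gcongr
      _ = _ := by rw [Real.sqrt_mul (by positivity), e2]; ring

end SLDG

/-! ### The error bounds -/

theorem theorem3 (k ℓ p : ℕ) (L c₀ : ℝ) (Q : SLDG.GaussLegendre k) :
    -- the general bound, for every numerical obstacle `gt`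
    (∃ C : ℝ, 0 ≤ C ∧ ∀ (c : ℝ) (g u₀ : ℝ → ℝ) (u : ℝ → ℝ → ℝ) (T : ℝ), 0 < c →
      Continuous g → Function.Periodic g 1 → SLDG.IsViscositySolution c g u₀ u →
      0 < T → SLDG.NotShattering ℓ p L c₀ T u →
      ∀ (N : ℕ) (m : SLDG.Mesh N) (dt : ℝ) (gt : ℝ → ℝ) (uh : ℕ → ℝ → ℝ), 0 < dt → dt ≤ T →
        SLDG.IsSLDGObstacleScheme m Q c dt u₀ gt uh →
        ∀ n : ℕ, n * dt ≤ T →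
          SLDG.l2Norm (fun x => uh n x - u (n * dt) x) ≤
            C * T * (m.h ^ SLDG.rateExp k ℓ / dt) +
            C * T * (SLDG.discreteNorm m Q (fun x => gt x - SLDG.obstacleMax c g dt x) / dt)) ∧
    -- (i) the exact running maximum as numerical obstacle
    (∃ C : ℝ, 0 ≤ C ∧ ∀ (c : ℝ) (g u₀ : ℝ → ℝ) (u : ℝ → ℝ → ℝ) (T : ℝ), 0 < c →
      Continuous g → Function.Periodic g 1 → SLDG.IsViscositySolution c g u₀ u →
      0 < T → SLDG.NotShattering ℓ p L c₀ T u →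
      ∀ (N : ℕ) (m : SLDG.Mesh N) (dt : ℝ) (uh : ℕ → ℝ → ℝ), 0 < dt → dt ≤ T →
        SLDG.IsSLDGObstacleScheme m Q c dt u₀ (SLDG.obstacleMax c g dt) uh →
        ∀ n : ℕ, n * dt ≤ T →
          SLDG.l2Norm (fun x => uh n x - u (n * dt) x) ≤
            C * T * (m.h ^ SLDG.rateExp k ℓ / dt)) ∧
    -- (ii) the two-point numerical obstacle
    (∀ (c : ℝ) (g : ℝ → ℝ) (q : ℕ), 0 < c →
      Continuous g → Function.Periodic g 1 → SLDG.DeltaTwo q g →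
      ∃ C : ℝ, 0 ≤ C ∧ ∀ (u₀ : ℝ → ℝ) (u : ℝ → ℝ → ℝ) (T : ℝ),
        SLDG.IsViscositySolution c g u₀ u → 0 < T → SLDG.NotShattering ℓ p L c₀ T u →
        ∀ (N : ℕ) (m : SLDG.Mesh N) (dt : ℝ) (uh : ℕ → ℝ → ℝ), 0 < dt → dt ≤ T →
          SLDG.IsSLDGObstacleScheme m Q c dt u₀ (SLDG.obstacleTwoPoint c g dt) uh →
          ∀ n : ℕ, n * dt ≤ T →
            SLDG.l2Norm (fun x => uh n x - u (n * dt) x) ≤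
              C * T * (m.h ^ SLDG.rateExp k ℓ / dt) + C * T * (dt * √(dt + m.h))) ∧
    -- the rate `h^(9/10)` for the two-point numerical obstacle and `dt ~ h^(3/5)`
    (1 ≤ k → 1 ≤ ℓ → ∀ (c : ℝ) (g : ℝ → ℝ) (q : ℕ), 0 < c →
      Continuous g → Function.Periodic g 1 → SLDG.DeltaTwo q g →
      ∀ α β : ℝ, 0 < α → α ≤ β →
      ∃ C : ℝ, 0 ≤ C ∧ ∀ (u₀ : ℝ → ℝ) (u : ℝ → ℝ → ℝ) (T : ℝ),
        SLDG.IsViscositySolution c g u₀ u → 0 < T → SLDG.NotShattering ℓ p L c₀ T u →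
        ∀ (N : ℕ) (m : SLDG.Mesh N) (dt : ℝ) (uh : ℕ → ℝ → ℝ), 0 < dt → dt ≤ T →
          α * m.h ^ (3 / 5 : ℝ) ≤ dt → dt ≤ β * m.h ^ (3 / 5 : ℝ) →
          SLDG.IsSLDGObstacleScheme m Q c dt u₀ (SLDG.obstacleTwoPoint c g dt) uh →
          ∀ n : ℕ, n * dt ≤ T →
            SLDG.l2Norm (fun x => uh n x - u (n * dt) x) ≤ C * T * m.h ^ (9 / 10 : ℝ)) := by
  refine ⟨SLDG.exists_general_bound k ℓ p L c₀ Q, ?_,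
    SLDG.exists_twoPoint_bound k ℓ p L c₀ Q, ?_⟩
  · obtain ⟨C, hC, hbd⟩ := SLDG.exists_general_bound k ℓ p L c₀ Q
    refine ⟨C, hC, fun c g u₀ u T hc hg hp hu hT hns N m dt uh hdt hdtT hs n hn => ?_⟩
    have h := hbd c g u₀ u T hc hg hp hu hT hns N m dt _ uh hdt hdtT hs n hn
    have h0 : SLDG.discreteNorm m Q
        (fun x => SLDG.obstacleMax c g dt x - SLDG.obstacleMax c g dt x) = 0 := by
      simp [SLDG.discreteNorm]
    rwa [h0, zero_div, mul_zero, add_zero] at h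
  · intro hk hℓ c g q hc hg hp hq α β hα hαβ
    obtain ⟨C, hC, hbd⟩ := SLDG.exists_twoPoint_bound k ℓ p L c₀ Q c g q hc hg hp hq
    have hβ : 0 ≤ β := hα.le.trans hαβ
    refine ⟨C * (α⁻¹ + β * √(β + 1)), by positivity,
      fun u₀ u T hu hT hns N m dt uh hdt hdtT h1 h2 hs n hn => ?_⟩
    have h := hbd u₀ u T hu hT hns N m dt uh hdt hdtT hs n hn
    rw [SLDG.rateExp_eq_of_one_le hk hℓ, ← mul_add] at h
    have h3 := SLDG.balance_le m.h_pos m.h_le_one hα hβ hdt h1 h2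
    calc _ ≤ _ := h
      _ ≤ C * T * ((α⁻¹ + β * √(β + 1)) * m.h ^ (9 / 10 : ℝ)) := by gcongr
      _ = _ := by ring
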